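/- Let $(X,d)$ be a metric space and let $2^X$ be the set of all nonempty closed subsets of $X$ with the metric $\min\{1,d_H\}$, where $d_H(A,B)=\max\{\sup_{x\in B}d(x,A),\sup_{x\in A}d(x,B)\}\in[0,\infty]$. For a closed set $F\subset X$ let $\mathcal D_0(F)$ be the set of all at most countable, discrete $D\in 2^X$ with $D\subset F$ such that $D$ is totally bounded or uniformly discrete in $X$ (that is, for some $\varepsilon>0$ every open ball of radius $\varepsilon$ in $X$ contains at most one point of $D$). An $\eta$-chain of length $l$ linking $x$ and $y$ in a metric space is a sequence $x=x_0,x_1,\dots,x_l=y$ of its points with $d(x_{i-1},x_i)<\eta$ for $1\le i\le l$; its diameter is the diameter of the set $\{x_0,\dots,x_l\}$. A continuity modulus is a non-decreasing function $\omega:(0,\infty)\to(0,\infty)$ with $\lim_{t\to+0}\omega(t)=0$; for a map $f$ between metric spaces, $\omega_f(t)=\sup\{\rho(f(x),f(x')):d(x,x')\le t\}$. For a metric space $(Y,\rho)$ and a subset $Y_0\subset Y$ we say that * $Y$ is an *absolute neighborhood retract* (ANR) if for every metric space $M$ containing $Y$ isometrically as a closed subset there is a continuous retraction $r:U\to Y$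 of some open neighborhood $U$ of $Y$ in $M$; * $Y$ is *locally path connected* if for every $y_0\in Y$ and every neighborhood $U$ of $y_0$ there is a neighborhood $V$ of $y_0$ such that every point of $V$ can be joined with $y_0$ by a path in $U$; * $Y$ is *locally chain connected at $Y_0$* if for every $y_0\in Y_0$ and $\varepsilon>0$ there is $\delta>0$ such that for every $\eta>0$ and every $y\in Y_0$ with $\rho(y,y_0)<\delta$ the points $y_0$ and $y$ are linked by an $\eta$-chain in $Y$ of diameter $<\varepsilon$; $Y$ is *locally chain connected* if this holds with $Y_0=Y$; * $Y$ is *uniformly locally chain equi-connected at $Y_0$* if $\forall\varepsilon>0\ \exists\delta>0\ \forall\eta>0\ \exists l\in\mathbb N$ such that any $x,y\in Y_0$ with $\rho(x,y)<\delta$ are linked by an $\eta$-chain in $Y$ of diameter $<\varepsilon$ and length $\le l$; * $Y$ is *uniformly locally trace equi-connected at $Y_0$* if there are $\varepsilon_0>0$ and a continuity modulus $\omega$ such that for any $x,y\in Y_0$ with $\rho(x,y)<\varepsilon_0$ and any countable dense subset $Q\supset\{0,\rho(x,y)\}$ of $[0,\rho(x,y)]$ there is a uniformly continuous $f:Q\to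 Y$ with $f(0)=x$, $f(\rho(x,y))=y$ and $\omega_f\le\omega$. **Theorem.** Let $\mathcal H\subset 2^X$ be an open subspace such that $\mathcal D_0(F)\subset\mathcal H$ for every $F\in\mathcal H$. Then the following conditions are equivalent: 1. $\mathcal H$ is an ANR; 2. $\mathcal H$ is locally path connected; 3. $\mathcal H$ is locally chain connected; 4. $2^X$ is locally chain connected at $\mathcal D_0(F)$ for each $F\in\mathcal H$; 5. $X$ is uniformly locally chain equi-connected at each $F\in\mathcal H$; 6. $X$ is uniformly locally trace equi-connected at each $F\in\mathcal H$. -/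

import Mathlib

open Set Filter Topology TopologicalSpace Metric
open scoped ENNReal

universe u

/-- The hyperspace `2^X` of all nonempty closed subsets of `X`. -/
structure Hyperspace (X : Type u) [TopologicalSpace X] extends Closeds X where
  nonempty' : carrier.Nonempty

namespace Hyperspace

theorem carrier_injective {X : Type u} [TopologicalSpace X] :
    Function.Injective (fun A : Hyperspace X => A.carrier) := by
  rintro ⟨⟨A, hA⟩, hA'⟩ ⟨⟨B, hB⟩, hB'⟩ h
  simp only at h
  subst h
  rfl

/-- The metric `min {1, d_H}` on `2^X`, where `d_H` is the (possibly infinite) Hausdorff distance. -/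
noncomputable instance instMetricSpace {X : Type u} [MetricSpace X] :
    MetricSpace (Hyperspace X) where
  dist A B := (min 1 (hausdorffEDist A.carrier B.carrier)).toReal
  dist_self A := by simp
  dist_comm A B := by rw [hausdorffEDist_comm]
  dist_triangle A B C := by
    have h1 : ∀ a : ℝ≥0∞, min 1 a ≠ ⊤ := fun a =>
      ne_top_of_le_ne_top ENNReal.one_ne_top (min_le_left _ _)
    rw [← ENNReal.toReal_add (h1 _) (h1 _)]
    refine ENNReal.toReal_mono (ENNReal.add_ne_top.2 ⟨h1 _, h1 _⟩) ?_
    have ht := hausdorffEDist_triangle (s := A.carrier) (t := B.carrier) (u := C.carrier)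
    rcases le_total 1 (hausdorffEDist A.carrier B.carrier) with h | h
    · rw [min_eq_left h]
      exact (min_le_left _ _).trans le_self_add
    · rcases le_total 1 (hausdorffEDist B.carrier C.carrier) with h' | h'
      · rw [min_eq_left h']
        exact (min_le_left _ _).trans le_add_self
      · rw [min_eq_right h, min_eq_right h']
        exact (min_le_right _ _).trans ht
  eq_of_dist_eq_zero := by
    intro A B h
    have h1 : min 1 (hausdorffEDist A.carrier B.carrier) = 0 := by
      rcases (ENNReal.toReal_eq_zero_iff _).1 h with h | h
      · exact h
      · exact absurd h (ne_top_of_le_ne_top ENNReal.one_ne_top (min_le_left _ _))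
    have h2 : hausdorffEDist A.carrier B.carrier = 0 := by
      rcases min_eq_iff.1 h1 with h | h
      · exact absurd h.1 one_ne_zero
      · exact h.1
    exact carrier_injective ((A.isClosed'.hausdorffEDist_zero_iff B.isClosed').1 h2)

theorem dist_def {X : Type u} [MetricSpace X] (A B : Hyperspace X) :
    dist A B = (min 1 (hausdorffEDist A.carrier B.carrier)).toReal := rfl

end Hyperspace

/-- `D` is uniformly discrete in `X`. -/
def IsUniformlyDiscrete {X : Type u} [MetricSpace X] (D : Set X) : Prop :=
  ∃ ε > 0, ∀ x : X, (D ∩ ball x ε).Subsingleton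

/-- `D₀(F)`: the nonempty closed subsets `D ⊆ F` of `X` which are discrete, at most countable, and
totally bounded or uniformly discrete in `X`. -/
def discreteHyperspace {X : Type u} [MetricSpace X] (F : Set X) : Set (Hyperspace X) :=
  {D | D.carrier ⊆ F ∧ IsDiscrete D.carrier ∧ D.carrier.Countable ∧
    (TotallyBounded D.carrier ∨ IsUniformlyDiscrete D.carrier)}

/-- `x` and `y` are linked by an `η`-chain `c 0, …, c l` in `Y` of length `l` and
diameter `< ε`. -/
def LinkedByChain {Y : Type u} [MetricSpace Y] (η ε : ℝ) (l : ℕ) (x y : Y) : Prop :=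
  ∃ c : ℕ → Y, c 0 = x ∧ c l = y ∧ (∀ i < l, dist (c i) (c (i + 1)) < η) ∧
    diam (c '' Iic l) < ε

/-- `Y` is locally chain connected at the subset `Y₀`; the chains run in `Y`. -/
def IsLocallyChainConnectedAt {Y : Type u} [MetricSpace Y] (Y₀ : Set Y) : Prop :=
  ∀ x₀ ∈ Y₀, ∀ ε > 0, ∃ δ > 0, ∀ η > 0, ∀ x ∈ Y₀, dist x x₀ < δ →
    ∃ l : ℕ, LinkedByChain η ε l x₀ x

/-- `Y` is locally chain connected. -/
def IsLocallyChainConnected (Y : Type u) [MetricSpace Y] : Prop :=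
  IsLocallyChainConnectedAt (univ : Set Y)

/-- `X` is uniformly locally chain equi-connected at the subset `X₀`; the chains run in `X`. -/
def IsUniformlyLocallyChainEquiConnectedAt {X : Type u} [MetricSpace X] (X₀ : Set X) : Prop :=
  ∀ ε > 0, ∃ δ > 0, ∀ η > 0, ∃ L : ℕ, ∀ x ∈ X₀, ∀ y ∈ X₀, dist x y < δ →
    ∃ l ≤ L, LinkedByChain η ε l x y

/-- A continuity modulus: a non-decreasing function `ω : (0, ∞) → (0, ∞)` tending to `0` at `0+`.
The values of `ω` on `(-∞, 0]` are irrelevant. -/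
structure IsContinuityModulus (ω : ℝ → ℝ) : Prop where
  pos : ∀ t > 0, 0 < ω t
  mono : MonotoneOn ω (Ioi 0)
  tendsto_zero : Tendsto ω (𝓝[>] 0) (𝓝 0)

/-- The continuity modulus `ω_f(t) = sup {ρ(f x, f x') : d(x, x') ≤ t}` of a map between
metric spaces, with values in `[0, ∞]`. -/
noncomputable def continuityModulus {Y Z : Type*} [MetricSpace Y] [MetricSpace Z]
    (f : Y → Z) (t : ℝ) : ℝ≥0∞ :=
  ⨆ (x : Y) (x' : Y) (_ : dist x x' ≤ t), edist (f x) (f x')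

/-- `X` is uniformly locally trace equi-connected at the subset `X₀`; the traces run in `X`. -/
def IsUniformlyLocallyTraceEquiConnectedAt {X : Type u} [MetricSpace X] (X₀ : Set X) : Prop :=
  ∃ ε₀ > 0, ∃ ω : ℝ → ℝ, IsContinuityModulus ω ∧
    ∀ x ∈ X₀, ∀ y ∈ X₀, dist x y < ε₀ →
      ∀ (Q : Set ℝ) (h0 : (0 : ℝ) ∈ Q) (h1 : dist x y ∈ Q), Q.Countable →
        Q ⊆ Icc 0 (dist x y) → Icc 0 (dist x y) ⊆ closure Q →
        ∃ f : Q → X, UniformContinuous f ∧ f ⟨0, h0⟩ = x ∧ f ⟨dist x y, h1⟩ = y ∧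
          ∀ t > 0, continuityModulus f t ≤ ENNReal.ofReal (ω t)

/-- `Y` is an absolute neighborhood retract: whenever `Y` is embedded isometrically onto a closed
subset of a metric space `M`, that subset is a retract of one of its open neighborhoods in `M`. -/
def IsANR (Y : Type u) [MetricSpace Y] : Prop :=
  ∀ (M : Type u) [MetricSpace M] (i : Y → M), Isometry i → IsClosed (range i) →
    ∃ (U : Set M) (hU : range i ⊆ U), IsOpen U ∧
      ∃ r : U → Y, Continuous r ∧ ∀ y : Y, r ⟨i y, hU (mem_range_self y)⟩ = y

/-! The conditions are proved equivalent in a cycle. From 1 to 2: a neighborhood retraction carries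
lifted line segments to paths. From 2 to 4: paths are subdivided into chains, and chains in the open
subspace are chains in the whole hyperspace.

From 4 to 5: a chain of sets can be followed by chains of points, all of the same length. Local
chain connectedness at one discrete set D therefore bounds uniformly the lengths of chains that
start anywhere near D (`IsLocallyChainConnectedAt.exists_chainIn`). If 5 fails, there are rows of
ever closer pairs in F that need ever longer chains (`UnlinkedPairs`). Taking limits of both indices
along an ultrafilter leaves two kinds of configuration. Either a uniformly discrete D, possibly a
single point, passes near enough bad pairs, and chains near D cannot jump between its points; or the
pairs approach a Cauchy sequence without limit, whose subsequences are discrete and totally bounded.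
Both contradict 4 (`UnlinkedPairs.elim`).

From 5 to 6: a pair of points is refined successively by chains whose lengths depend only on the
level. This gives a map on a dense set of times with a modulus independent of the pair. A
2-Lipschitz map of any other countable set of times into that dense set transfers it
(`exists_lipschitz_map_into_dense`). Chains may leave F, so 5 is applied to a closed neighborhood of
F, which still lies in the open family.

From 6 to 1: this is a Dugundji-type extension in which growing sets replace convex combinations.
Traces from A to nearby points of B let A grow continuously until it contains B
(`IsUniformlyLocallyTraceEquiConnectedAt.exists_growth`). Bump functions outside the closed copy of
the family, with anchor sets in it, tell which growths to unite and at which times; the closure of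
the union is the value of the retraction (`isANR_of_trace`). -/

namespace Hyperspace

/-! ### The truncated Hausdorff metric in terms of points -/

variable {X : Type u} [MetricSpace X]

theorem exists_dist_lt {A B : Hyperspace X} {r : ℝ} (h : dist A B < r) (hr : r ≤ 1) {x : X}
    (hx : x ∈ A.carrier) : ∃ y ∈ B.carrier, dist x y < r := by
  rw [dist_def] at h
  have h1 : min 1 (hausdorffEDist A.carrier B.carrier) < ENNReal.ofReal r :=
    (ENNReal.lt_ofReal_iff_toReal_lt
      (ne_top_of_le_ne_top ENNReal.one_ne_top (min_le_left _ _))).2 h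
  have h2 : hausdorffEDist A.carrier B.carrier < ENNReal.ofReal r := by
    rcases min_lt_iff.1 h1 with h1 | h1
    · exact absurd (h1.trans_le (ENNReal.ofReal_le_ofReal hr)) (by simp)
    · exact h1
  obtain ⟨y, hy, hxy⟩ := exists_edist_lt_of_hausdorffEDist_lt hx h2
  exact ⟨y, hy, by rwa [edist_lt_ofReal] at hxy⟩

theorem dist_le_of_mem {A B : Hyperspace X} {r : ℝ} (hr : 0 ≤ r)
    (hAB : ∀ x ∈ A.carrier, ∃ y ∈ B.carrier, dist x y ≤ r)
    (hBA : ∀ x ∈ B.carrier, ∃ y ∈ A.carrier, dist x y ≤ r) : dist A B ≤ r := by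
  have : hausdorffEDist A.carrier B.carrier ≤ ENNReal.ofReal r := by
    refine hausdorffEDist_le_of_mem_edist (fun x hx => ?_) (fun x hx => ?_)
    · obtain ⟨y, hy, h⟩ := hAB x hx
      exact ⟨y, hy, (edist_le_ofReal hr).2 h⟩
    · obtain ⟨y, hy, h⟩ := hBA x hx
      exact ⟨y, hy, (edist_le_ofReal hr).2 h⟩
  rw [dist_def]
  exact ENNReal.toReal_le_of_le_ofReal hr ((min_le_right _ _).trans this)

/-- The closed `r`-neighborhood of a point of the hyperspace. -/
def cthicken (r : ℝ) (A : Hyperspace X) : Hyperspace X where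
  carrier := cthickening r A.carrier
  isClosed' := isClosed_cthickening
  nonempty' := A.nonempty'.mono (self_subset_cthickening _)

/-- This is how openness enters the later constructions: chains and traces that start in F leave it,
so the equi-connectedness conditions are used at a closed neighborhood of F. -/
theorem exists_cthicken_mem {H : Set (Hyperspace X)} (hH : IsOpen H) {F : Hyperspace X}
    (hF : F ∈ H) : ∃ r, 0 < r ∧ r ≤ 1 ∧ ball F r ⊆ H ∧ cthicken r F ∈ H := by
  obtain ⟨ε, hε, hb⟩ := Metric.isOpen_iff.1 hH F hF
  have hr : 0 < min (ε / 4) 1 := by positivity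
  have hr' : min (ε / 4) 1 ≤ ε / 4 := min_le_left _ _
  refine ⟨min (ε / 4) 1, hr, min_le_right _ _, (ball_subset_ball (by linarith)).trans hb, hb ?_⟩
  refine mem_ball.2 ((dist_le_of_mem (r := ε / 2) (by positivity) ?_ ?_).trans_lt (by linarith))
  · intro x hx
    have : x ∈ thickening (ε / 2) F.carrier :=
      cthickening_subset_thickening' (by linarith) (by linarith) _ hx
    obtain ⟨z, hz, h⟩ := mem_thickening_iff.1 this
    exact ⟨z, hz, h.le⟩
  · intro x hx
    exact ⟨x, self_subset_cthickening _ hx, by simpa using (half_pos hε).le⟩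

end Hyperspace

/-! ### Calculus of chains -/

/-- `x` and `y` are linked by an `η`-chain of length `l` all of whose points lie in `s`. -/
def ChainIn {X : Type*} [MetricSpace X] (s : Set X) (η : ℝ) (l : ℕ) (x y : X) : Prop :=
  ∃ c : ℕ → X, c 0 = x ∧ c l = y ∧ (∀ i < l, dist (c i) (c (i + 1)) < η) ∧ ∀ i ≤ l, c i ∈ s

namespace ChainIn

variable {X : Type*} [MetricSpace X] {s t : Set X} {η θ : ℝ} {l m : ℕ} {x y z : X}

theorem symm (h : ChainIn s η l x y) : ChainIn s η l y x := by
  obtain ⟨c, h0, h1, h2, h3⟩ := h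
  refine ⟨fun i => c (l - i), by simpa, by simpa, fun i hi => ?_, fun i _ => h3 _ (by omega)⟩
  have := h2 (l - (i + 1)) (by omega)
  rw [dist_comm] at this
  rwa [show l - (i + 1) + 1 = l - i by omega] at this

theorem trans (h : ChainIn s η l x y) (h' : ChainIn s η m y z) : ChainIn s η (l + m) x z := by
  obtain ⟨c, h0, h1, h2, h3⟩ := h
  obtain ⟨d, k0, k1, k2, k3⟩ := h'
  refine ⟨fun i => if i ≤ l then c i else d (i - l), by simpa, ?_, fun i hi => ?_, fun i hi => ?_⟩
  · by_cases hm : m = 0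
    · subst hm; simp [h1, ← k0, k1]
    · simp [hm, k1]
  · rcases lt_trichotomy i l with h | h | h
    · simpa [h.le, Nat.succ_le_of_lt h] using h2 i h
    · subst h
      simpa [h1, ← k0] using k2 0 (by omega)
    · have := k2 (i - l) (by omega)
      simpa [h.not_ge, show ¬ i + 1 ≤ l by omega, show i + 1 - l = i - l + 1 by omega] using this
  · rcases le_or_gt i l with h | h
    · simpa [h] using h3 i h
    · simpa [h.not_ge] using k3 (i - l) (by omega)

theorem mono (h : ChainIn s η l x y) (hs : s ⊆ t) (hη : η ≤ θ) : ChainIn t θ l x y := by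
  obtain ⟨c, h0, h1, h2, h3⟩ := h
  exact ⟨c, h0, h1, fun i hi => (h2 i hi).trans_le hη, fun i hi => hs (h3 i hi)⟩

theorem mem_left (h : ChainIn s η l x y) : x ∈ s := by
  obtain ⟨c, h0, h1, h2, h3⟩ := h
  exact h0 ▸ h3 0 (Nat.zero_le _)

theorem mem_right (h : ChainIn s η l x y) : y ∈ s := h.symm.mem_left

theorem refl (hx : x ∈ s) (hη : 0 < η) (l : ℕ) : ChainIn s η l x x :=
  ⟨fun _ => x, rfl, rfl, fun _ _ => by simpa, fun _ _ => hx⟩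

theorem length_mono (h : ChainIn s η l x y) (hη : 0 < η) (hlm : l ≤ m) : ChainIn s η m x y := by
  have := h.trans (refl h.mem_right hη (m - l))
  rwa [Nat.add_sub_cancel' hlm] at this

theorem single (hx : x ∈ s) (hy : y ∈ s) (h : dist x y < η) : ChainIn s η 1 x y := by
  refine ⟨fun i => if i = 0 then x else y, by simp, by simp, fun i hi => ?_, fun i _ => ?_⟩
  · obtain rfl : i = 0 := by omega
    simpa
  · dsimp only
    split_ifs <;> assumption

theorem linkedByChain {X : Type u} [MetricSpace X] {s : Set X} {η : ℝ} {l : ℕ} {x y : X}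
    (h : ChainIn s η l x y) {r ε : ℝ} (hr : 0 ≤ r) (hs : ∀ x ∈ s, ∀ y ∈ s, dist x y ≤ r)
    (hε : r < ε) : LinkedByChain η ε l x y := by
  obtain ⟨c, h0, h1, h2, h3⟩ := h
  refine ⟨c, h0, h1, h2, (diam_le_of_forall_dist_le hr ?_).trans_lt hε⟩
  rintro _ ⟨i, hi, rfl⟩ _ ⟨j, hj, rfl⟩
  exact hs _ (h3 i hi) _ (h3 j hj)

theorem linkedByChain_of_ball {X : Type u} [MetricSpace X] {η : ℝ} {l : ℕ} {x y p : X}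
    {r ε : ℝ} (h : ChainIn (ball p r) η l x y) (hε : 2 * r < ε) : LinkedByChain η ε l x y := by
  have hr : 0 < r := pos_of_mem_ball h.mem_left
  refine h.linkedByChain (r := 2 * r) (by positivity) (fun x hx y hy => ?_) hε
  rw [mem_ball] at hx hy
  linarith [dist_triangle_right x y p]

end ChainIn

theorem LinkedByChain.dist_lt {X : Type u} [MetricSpace X] {η ε : ℝ} {l : ℕ} {x y : X}
    (h : LinkedByChain η ε l x y) : ∃ c : ℕ → X, c 0 = x ∧ c l = y ∧
      (∀ i < l, dist (c i) (c (i + 1)) < η) ∧ ∀ i ≤ l, ∀ j ≤ l, dist (c i) (c j) < ε := by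
  obtain ⟨c, h0, h1, h2, h3⟩ := h
  refine ⟨c, h0, h1, h2, fun i hi j hj => lt_of_le_of_lt ?_ h3⟩
  exact dist_le_diam_of_mem ((finite_Iic l).image c).isBounded (mem_image_of_mem _ hi)
    (mem_image_of_mem _ hj)

theorem LinkedByChain.chainIn {X : Type u} [MetricSpace X] {η ε : ℝ} {l : ℕ} {x y : X}
    (h : LinkedByChain η ε l x y) : ChainIn (ball x ε) η l x y := by
  obtain ⟨c, h0, h1, h2, h3⟩ := h.dist_lt
  exact ⟨c, h0, h1, h2, fun i hi => by simpa [h0] using h3 i hi 0 (Nat.zero_le _)⟩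

/-! ### From retractions to paths, and from paths to chains -/

/-- The isometric embedding `y ↦ d(y, ·) - d(p, ·)` into the bounded functions. -/
noncomputable def distEmbedding {Y : Type u} [MetricSpace Y] (p y : Y) :
    BoundedContinuousFunction Y ℝ :=
  BoundedContinuousFunction.ofNormedAddCommGroup (fun z => dist y z - dist p z)
    (by fun_prop) (dist y p) (fun z => by
      rw [Real.norm_eq_abs]; exact abs_dist_sub_le _ _ _)

theorem isometry_distEmbedding {Y : Type u} [MetricSpace Y] (p : Y) :
    Isometry (distEmbedding p) := by
  refine Isometry.of_dist_eq fun y y' => le_antisymm ?_ ?_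
  · refine (BoundedContinuousFunction.dist_le dist_nonneg).2 fun z => ?_
    simp only [distEmbedding, BoundedContinuousFunction.coe_ofNormedAddCommGroup, Real.dist_eq]
    simpa using abs_dist_sub_le y y' z
  · refine le_trans ?_ (BoundedContinuousFunction.dist_coe_le_dist y')
    simp [distEmbedding]

theorem IsANR.locallyPathConnectedSpace {Y : Type u} [MetricSpace Y] (h : IsANR Y) :
    LocallyPathConnectedSpace Y := by
  rw [locallyPathConnectedSpace_iff_pathComponentIn_mem_nhds]
  intro y₀ u hu hy₀
  classical
  let κ := distEmbedding y₀
  have hκ : Isometry κ := isometry_distEmbedding y₀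
  -- The image of `κ` need not be closed. Attaching it as the bottom of an open upper half-space
  -- makes it closed, as the set of height zero.
  let M := {q : BoundedContinuousFunction Y ℝ × ℝ // 0 < q.2 ∨ q.2 = 0 ∧ q.1 ∈ range κ}
  let i : Y → M := fun y => ⟨(κ y, 0), Or.inr ⟨rfl, mem_range_self y⟩⟩
  have hi : Isometry i := Isometry.of_dist_eq fun y y' => by
    rw [Subtype.dist_eq, Prod.dist_eq]
    simp [i, hκ.dist_eq]
  have hr : range i = {q : M | q.1.2 ≤ 0} := by
    ext ⟨⟨v, t⟩, hq⟩
    simp only [mem_range, mem_ofPred_eq]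
    constructor
    · rintro ⟨y, hy⟩
      have := congrArg (fun q : M => q.1.2) hy
      simpa [i] using this.ge
    · intro ht
      rcases hq with hq | ⟨h0, y, hy⟩
      · exact absurd ht (not_le.2 hq)
      · exact ⟨y, Subtype.ext (Prod.ext hy h0.symm)⟩
  have hcl : IsClosed (range i) := by
    rw [hr]
    exact isClosed_le (by fun_prop) continuous_const
  obtain ⟨U, hU, hUo, r, hrc, hri⟩ := h M i hi hcl
  let R : M → Y := fun m => if hm : m ∈ U then r ⟨m, hm⟩ else y₀
  have hRi : ∀ y, R (i y) = y := fun y => by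
    simp only [R, dif_pos (hU (mem_range_self y)), hri]
  have hRc : ContinuousOn R U := by
    rw [continuousOn_iff_continuous_domRestrict]
    convert hrc using 1
    ext1 ⟨m, hm⟩
    simp [R, hm]
  have hW : IsOpen (U ∩ R ⁻¹' u) := hRc.isOpen_inter_preimage hUo hu
  obtain ⟨ρ, hρ, hb⟩ := Metric.isOpen_iff.1 hW (i y₀) ⟨hU (mem_range_self y₀), by simpa [hRi]⟩
  refine Filter.mem_of_superset (ball_mem_nhds y₀ hρ) fun y hy => ?_
  have hM : ∀ t : unitInterval, 0 < (t : ℝ) * (1 - t) * ρ ∨ (t : ℝ) * (1 - t) * ρ = 0 ∧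
      (1 - t : ℝ) • κ y₀ + (t : ℝ) • κ y ∈ range κ := by
    intro t
    rcases eq_or_ne (t : ℝ) 0 with h0 | h0
    · exact Or.inr ⟨by simp [h0], y₀, by simp [h0]⟩
    rcases eq_or_ne (t : ℝ) 1 with h1 | h1
    · exact Or.inr ⟨by simp [h1], y, by simp [h1]⟩
    have ht0 : (0 : ℝ) < t := lt_of_le_of_ne t.2.1 (Ne.symm h0)
    have ht1 : (t : ℝ) < 1 := lt_of_le_of_ne t.2.2 h1
    exact Or.inl (mul_pos (mul_pos ht0 (by linarith)) hρ)
  -- The segment is lifted to positive height in its interior, where any point of the normed space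
  -- is allowed; both ends lie on the copy of `Y`.
  let γ : unitInterval → M := fun t =>
    ⟨((1 - t : ℝ) • κ y₀ + (t : ℝ) • κ y, (t : ℝ) * (1 - t) * ρ), hM t⟩
  have hγ : Continuous γ := Continuous.subtype_mk (by fun_prop) _
  have hγW : ∀ t, γ t ∈ U ∩ R ⁻¹' u := by
    intro t
    refine hb (mem_ball.2 ?_)
    rw [Subtype.dist_eq, Prod.dist_eq]
    refine max_lt ?_ ?_
    · have : (1 - t : ℝ) • κ y₀ + (t : ℝ) • κ y - κ y₀ = (t : ℝ) • (κ y - κ y₀) := by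
        module
      simp only [γ, i, dist_eq_norm]
      rw [this, norm_smul, ← dist_eq_norm, hκ.dist_eq, Real.norm_eq_abs, abs_of_nonneg t.2.1]
      exact lt_of_le_of_lt (mul_le_of_le_one_left dist_nonneg t.2.2) hy
    · have h1 : (t : ℝ) * (1 - t) ≤ 1 / 4 := by nlinarith [sq_nonneg ((t : ℝ) - 1 / 2)]
      have h2 : 0 ≤ (t : ℝ) * (1 - t) := mul_nonneg t.2.1 (by linarith [t.2.2])
      simp only [γ, i, Real.dist_eq, sub_zero]
      rw [abs_of_nonneg (by positivity)]
      nlinarith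
  refine ⟨⟨⟨fun t => R (γ t), hRc.comp_continuous hγ fun t => (hγW t).1⟩, ?_, ?_⟩,
    fun t => (hγW t).2⟩
  · have : γ 0 = i y₀ := Subtype.ext (by simp [γ, i])
    simp only [this, hRi]
  · have : γ 1 = i y := Subtype.ext (by simp [γ, i])
    simp only [this, hRi]

theorem isLocallyChainConnected_of_locallyPathConnectedSpace {Y : Type u} [MetricSpace Y]
    [LocallyPathConnectedSpace Y] : IsLocallyChainConnected Y := by
  intro x₀ _ ε hε
  obtain ⟨s, ⟨hs, hsp⟩, hsb⟩ := (path_connected_basis x₀).mem_iff.1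
    (ball_mem_nhds x₀ (show 0 < ε / 3 by positivity))
  obtain ⟨δ, hδ, hδs⟩ := Metric.mem_nhds_iff.1 hs
  refine ⟨δ, hδ, fun η hη x _ hx => ?_⟩
  obtain ⟨γ, hγ⟩ := hsp.joinedIn x₀ (mem_of_mem_nhds hs) x (hδs hx)
  obtain ⟨τ, hτ, hγτ⟩ := Metric.uniformContinuous_iff.1
    (CompactSpace.uniformContinuous_of_continuous γ.continuous) η hη
  obtain ⟨n, hn⟩ := exists_nat_one_div_lt hτ
  have hI : ∀ i : ℕ, i ≤ n + 1 → (i / (n + 1 : ℝ)) ∈ unitInterval := fun i hi =>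
    ⟨by positivity, by rw [div_le_one (by positivity)]; exact_mod_cast hi⟩
  refine ⟨n + 1, ChainIn.linkedByChain_of_ball (p := x₀) (r := ε / 3) ?_ (by linarith)⟩
  refine ⟨fun i => γ.extend (i / (n + 1 : ℝ)), by simp, ?_, fun i hi => ?_, fun i hi => ?_⟩
  · have : ((n + 1 : ℕ) : ℝ) / (n + 1) = 1 := by push_cast; field_simp
    simp only [this, γ.extend_one]
  · simp only []
    rw [γ.extend_apply (hI i (by omega)), γ.extend_apply (hI (i + 1) (by omega))]
    refine hγτ ?_
    rw [Subtype.dist_eq, Real.dist_eq, abs_sub_comm]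
    rw [show ((i + 1 : ℕ) : ℝ) / (n + 1) - i / (n + 1) = 1 / (n + 1) by push_cast; ring,
      abs_of_pos (by positivity)]
    exact hn
  · simp only []
    rw [γ.extend_apply (hI i hi)]
    exact hsb (hγ _)

theorem IsLocallyChainConnected.discreteHyperspace {X : Type u} [MetricSpace X]
    {H : Set (Hyperspace X)} (h : IsLocallyChainConnected H) {F : Set X}
    (hF : discreteHyperspace F ⊆ H) : IsLocallyChainConnectedAt (discreteHyperspace F) := by
  intro D hD ε hε
  obtain ⟨δ, hδ, hδ'⟩ := h ⟨D, hF hD⟩ (mem_univ _) ε hε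
  refine ⟨δ, hδ, fun η hη E hE hED => ?_⟩
  obtain ⟨l, c, h0, h1, h2, h3⟩ := hδ' η hη ⟨E, hF hE⟩ (mem_univ _) hED
  refine ⟨l, fun i => c i, by simp [h0], by simp [h1], h2, ?_⟩
  rwa [show (fun i => (c i : Hyperspace X)) '' Iic l = Subtype.val '' (c '' Iic l) by
    rw [image_image], isometry_subtype_coe.diam_image]

/-! ### From chains of discrete sets to equi-bounded chains of points -/

theorem isClosed_of_pairwise_dist {X : Type*} [MetricSpace X] {T : Set X} {r : ℝ} (hr : 0 < r)
    (hT : T.Pairwise fun x y => r ≤ dist x y) : IsClosed T :=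
  Metric.isClosed_of_pairwise_le_dist hr hT

theorem exists_mem_discreteHyperspace {X : Type u} [MetricSpace X] {F T : Set X} (hTF : T ⊆ F)
    (hne : T.Nonempty) (hc : T.Countable) (hcl : ∀ T' ⊆ T, IsClosed T')
    (h : TotallyBounded T ∨ IsUniformlyDiscrete T) :
    ∃ D ∈ discreteHyperspace F, D.carrier = T := by
  refine ⟨⟨⟨T, hcl T Subset.rfl⟩, hne⟩, ⟨hTF, ?_, hc, h⟩, rfl⟩
  rw [isDiscrete_iff_forall_mem_exists_isClosed]
  exact fun s hs => ⟨s, hcl s hs, inter_eq_left.2 hs⟩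

theorem exists_mem_discreteHyperspace_of_pairwise {X : Type u} [MetricSpace X] {F T : Set X}
    (hTF : T ⊆ F) (hne : T.Nonempty) (hc : T.Countable) {r : ℝ} (hr : 0 < r)
    (hT : T.Pairwise fun x y => r ≤ dist x y) : ∃ D ∈ discreteHyperspace F, D.carrier = T := by
  refine exists_mem_discreteHyperspace hTF hne hc
    (fun T' h' => isClosed_of_pairwise_dist hr (hT.mono h')) (Or.inr ⟨r / 2, by positivity, ?_⟩)
  rintro p x ⟨hx, hxp⟩ y ⟨hy, hyp⟩
  by_contra hxy
  have := hT hx hy hxy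
  rw [mem_ball] at hxp hyp
  linarith [dist_triangle_right x y p]

theorem exists_maximal_separated {X : Type*} [MetricSpace X] (S : Set X) {r : ℝ} (hr : 0 < r) :
    ∃ E ⊆ S, (E.Pairwise fun x y => r ≤ dist x y) ∧ ∀ x ∈ S, ∃ e ∈ E, dist x e < r := by
  obtain ⟨E, hE⟩ := zorn_subset {E : Set X | E ⊆ S ∧ E.Pairwise fun x y => r ≤ dist x y} (by
    intro c hc hchain
    refine ⟨⋃₀ c, ⟨sUnion_subset fun s hs => (hc hs).1, ?_⟩, fun s hs => subset_sUnion_of_mem hs⟩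
    rw [pairwise_sUnion hchain.directedOn]
    exact fun s hs => (hc hs).2)
  refine ⟨E, hE.prop.1, hE.prop.2, fun x hx => ?_⟩
  by_contra! hcon
  have hx' : x ∈ E := by
    refine hE.le_of_ge (y := insert x E) ⟨insert_subset hx hE.prop.1, ?_⟩ (subset_insert x E)
      (mem_insert x E)
    rw [pairwise_insert]
    exact ⟨hE.prop.2, fun y hy _ => ⟨hcon y hy, dist_comm x y ▸ hcon y hy⟩⟩
  exact absurd (hcon x hx') (by simpa)

theorem LinkedByChain.symm {Y : Type u} [MetricSpace Y] {η ε : ℝ} {l : ℕ} {x y : Y}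
    (h : LinkedByChain η ε l x y) : LinkedByChain η ε l y x := by
  obtain ⟨c, h0, h1, h2, h3⟩ := h
  refine ⟨fun i => c (l - i), by simpa, by simpa, fun i hi => ?_, ?_⟩
  · have := h2 (l - (i + 1)) (by omega)
    rw [dist_comm] at this
    rwa [show l - (i + 1) + 1 = l - i by omega] at this
  · refine lt_of_le_of_lt (diam_mono ?_ ((finite_Iic l).image c).isBounded) h3
    rintro _ ⟨i, _, rfl⟩
    exact mem_image_of_mem _ (Nat.sub_le _ _)

/-- A chain in the hyperspace can be followed by chains of points. -/
theorem LinkedByChain.exists_chainIn {X : Type u} [MetricSpace X] {D E : Hyperspace X} {η ε : ℝ}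
    {l : ℕ} (h : LinkedByChain η ε l D E) (hη : η ≤ 1) (hε : ε ≤ 1) {x : X} (hx : x ∈ D.carrier) :
    ∃ y ∈ E.carrier, ChainIn (thickening ε D.carrier ∩ thickening ε E.carrier) η l x y := by
  obtain ⟨C, h0, h1, h2, h3⟩ := h.dist_lt
  have key : ∀ k ≤ l, ∃ c : ℕ → X, c 0 = x ∧ (∀ i < k, dist (c i) (c (i + 1)) < η) ∧
      ∀ i ≤ k, c i ∈ (C i).carrier := by
    intro k
    induction k with
    | zero =>
      refine fun _ => ⟨fun _ => x, rfl, by simp, fun i hi => ?_⟩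
      obtain rfl : i = 0 := by omega
      rwa [h0]
    | succ k ih =>
      intro hk
      obtain ⟨c, c0, c1, c2⟩ := ih (by omega)
      -- Steps below 1 are not affected by the truncation of the metric, so each point has a
      -- successor in the next set.
      obtain ⟨p, hp, hcp⟩ := Hyperspace.exists_dist_lt (h2 k (by omega)) hη (c2 k le_rfl)
      refine ⟨fun i => if i ≤ k then c i else p, by simpa, fun i hi => ?_, fun i hi => ?_⟩
      · rcases Nat.lt_succ_iff_lt_or_eq.1 hi with h | rfl
        · simpa [h.le, Nat.succ_le_of_lt h] using c1 i h
        · simpa using hcp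
      · rcases le_or_gt i k with h | h
        · simpa [h] using c2 i h
        · obtain rfl : i = k + 1 := by omega
          simpa using hp
  obtain ⟨c, c0, c1, c2⟩ := key l le_rfl
  refine ⟨c l, h1 ▸ c2 l le_rfl, c, c0, rfl, c1, fun i hi => ⟨?_, ?_⟩⟩
  · obtain ⟨z, hz, hd⟩ := Hyperspace.exists_dist_lt (h3 i hi 0 (Nat.zero_le _)) hε (c2 i hi)
    exact mem_thickening_iff.2 ⟨z, h0 ▸ hz, hd⟩
  · obtain ⟨z, hz, hd⟩ := Hyperspace.exists_dist_lt (h3 i hi l le_rfl) hε (c2 i hi)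
    exact mem_thickening_iff.2 ⟨z, h1 ▸ hz, hd⟩

/-- A chain with small steps near a separated set stays near one of its points. -/
theorem ChainIn.ball_of_pairwise {X : Type*} [MetricSpace X] {D : Set X} {r ε η : ℝ} {l : ℕ}
    {x y z : X} (hD : D.Pairwise fun x y => r ≤ dist x y) (h : ChainIn (thickening ε D) η l x y)
    (hη : 0 ≤ η) (hr : 2 * ε + η ≤ r) (hy : y ∈ D) (hz : z ∈ D) (hxz : dist x z < ε) :
    ChainIn (ball z ε) η l x z := by
  obtain ⟨c, h0, h1, h2, h3⟩ := h
  have key : ∀ i ≤ l, dist (c i) z < ε := by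
    intro i
    induction i with
    | zero => intro _; rwa [h0]
    | succ i ih =>
      intro hi
      obtain ⟨w, hw, hcw⟩ := mem_thickening_iff.1 (h3 (i + 1) hi)
      by_cases hwz : w = z
      · rwa [← hwz]
      · have h4 := hD hw hz hwz
        have h5 := ih (by omega)
        have h6 := h2 i (by omega)
        have h7 := dist_triangle4 w (c (i + 1)) (c i) z
        rw [dist_comm] at hcw h6
        linarith
  have hyz : y = z := by
    by_contra hyz
    have h4 := hD hy hz hyz
    have h5 := key l le_rfl
    rw [h1] at h5
    linarith [dist_nonneg.trans_lt hxz]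
  exact ⟨c, h0, hyz ▸ h1, h2, key⟩

/-- A single chain of sets ending at D serves all points of `S` at once, which is why `K` does not
depend on the point. -/
theorem IsLocallyChainConnectedAt.exists_chainIn {X : Type u} [MetricSpace X] {F : Set X}
    (h : IsLocallyChainConnectedAt (discreteHyperspace F)) {D : Hyperspace X}
    (hD : D ∈ discreteHyperspace F) {ε : ℝ} (hε : 0 < ε) :
    ∃ δ > 0, ∀ η, 0 < η → η < δ → ∀ S ⊆ F, S.Countable →
      (∀ s ∈ S, ∃ z ∈ D.carrier, dist s z < δ) →
      ∃ K, ∀ s ∈ S, ∃ z ∈ D.carrier, ChainIn (thickening ε D.carrier) η K s z := by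
  obtain ⟨δ₁, hδ₁, h₁⟩ := h D hD (min ε 1) (by positivity)
  have hδ0 : 0 < min (δ₁ / 2) (min ε 1) := by positivity
  set δ := min (δ₁ / 2) (min ε 1) with hδ
  have hδ1 : δ ≤ δ₁ / 2 := min_le_left _ _
  have hδ2 : δ ≤ ε := (min_le_right _ _).trans (min_le_left _ _)
  have hδ3 : δ ≤ 1 := (min_le_right _ _).trans (min_le_right _ _)
  refine ⟨δ, hδ0, fun η hη hηδ S hSF hSc hS => ?_⟩
  -- `S` itself need not be discrete. A maximal `η`-separated subset is, and passing to it costs one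
  -- extra step of the chain. Including D keeps it Hausdorff close to D, since `η < δ`.
  obtain ⟨T, hTS, hTp, hT⟩ := exists_maximal_separated (S ∪ D.carrier) hη
  have hTne : T.Nonempty := by
    obtain ⟨z, hz⟩ := D.nonempty'
    obtain ⟨e, he, -⟩ := hT z (Or.inr hz)
    exact ⟨e, he⟩
  obtain ⟨E, hE, rfl⟩ := exists_mem_discreteHyperspace_of_pairwise
    (hTS.trans (union_subset hSF hD.1)) hTne ((hSc.union hD.2.2.1).mono hTS) hη hTp
  have hED : dist E D < δ₁ := by
    refine (Hyperspace.dist_le_of_mem hδ0.le (fun x hx => ?_) fun z hz => ?_).trans_lt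
      (by linarith)
    · rcases hTS hx with hx | hx
      · obtain ⟨z, hz, hd⟩ := hS x hx
        exact ⟨z, hz, hd.le⟩
      · exact ⟨x, hx, by simpa using hδ0.le⟩
    · obtain ⟨e, he, hd⟩ := hT z (Or.inr hz)
      exact ⟨e, he, (hd.trans hηδ).le⟩
  obtain ⟨l, hl⟩ := h₁ η hη E hE hED
  refine ⟨1 + l, fun s hs => ?_⟩
  obtain ⟨e, he, hse⟩ := hT s (Or.inl hs)
  obtain ⟨z, hz, hc⟩ := hl.symm.exists_chainIn (by linarith) (min_le_right _ _) he
  have hc' := hc.mono (inter_subset_right.trans (thickening_mono (min_le_left ε 1) _)) le_rfl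
  obtain ⟨w, hw, hsw⟩ := hS s hs
  exact ⟨z, hz, (ChainIn.single (mem_thickening_iff.2 ⟨w, hw, hsw.trans_le hδ2⟩)
    hc'.mem_left hse).trans hc'⟩

theorem exists_seq_of_forall_finset {α : Type*} (P : ℕ → α → Prop) (r : α → α → Prop)
    (h : ∀ n (s : Finset α), ∃ y, P n y ∧ ∀ x ∈ s, r x y) :
    ∃ f : ℕ → α, (∀ n, P n (f n)) ∧ ∀ m n, m < n → r (f m) (f n) := by
  classical
  choose g hgP hgr using h
  let S : ℕ → Finset α := fun n => Nat.rec ∅ (fun n s => insert (g n s) s) n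
  have hS : ∀ n, S (n + 1) = insert (g n (S n)) (S n) := fun n => rfl
  have hmono : Monotone S := monotone_nat_of_le_succ fun n => by
    rw [hS]; exact Finset.subset_insert _ _
  refine ⟨fun n => g n (S n), fun n => hgP n _, fun m n hmn => hgr n _ _ ?_⟩
  exact hmono (Nat.succ_le_of_lt hmn) (by rw [hS]; exact Finset.mem_insert_self _ _)

/-- Such a sequence eventually stays away from every given point, so only finitely many terms are
near it. -/
theorem isClosed_of_subset_range_of_cauchySeq {X : Type*} [MetricSpace X] {a : ℕ → X}
    (ha : CauchySeq a) (hlim : ∀ p, ¬ Tendsto a atTop (𝓝 p)) {T : Set X} (hT : T ⊆ range a) :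
    IsClosed T := by
  refine isClosed_of_closure_subset fun p hp => ?_
  have hr : ∃ r > 0, ∀ᶠ j in atTop, r ≤ dist (a j) p := by
    have := hlim p
    rw [Metric.tendsto_atTop] at this
    push Not at this
    obtain ⟨e, he, hfr⟩ := this
    obtain ⟨N, hN⟩ := Metric.cauchySeq_iff.1 ha (e / 2) (by positivity)
    obtain ⟨m, hm, hme⟩ := hfr N
    refine ⟨e / 2, by positivity, (eventually_ge_atTop N).mono fun j hj => ?_⟩
    have := hN m hm j hj
    linarith [dist_triangle (a m) (a j) p]
  obtain ⟨r, hr, hev⟩ := hr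
  obtain ⟨N, hN⟩ := eventually_atTop.1 hev
  have hsub : T ∩ ball p r ⊆ a '' Iio N ∩ T := by
    rintro q ⟨hq, hqp⟩
    obtain ⟨j, rfl⟩ := hT hq
    refine ⟨⟨j, ?_, rfl⟩, hq⟩
    by_contra hj
    exact absurd (hN j (not_lt.1 hj)) (not_le.2 hqp)
  have hfin : (a '' Iio N ∩ T).Finite := ((finite_Iio N).image a).inter_of_left _
  have hp' : p ∈ closure (T ∩ ball p r) := by
    rw [mem_closure_iff_nhds] at hp ⊢
    intro t ht
    obtain ⟨q, ⟨hq1, hq2⟩, hq3⟩ := hp (t ∩ ball p r) (inter_mem ht (ball_mem_nhds p hr))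
    exact ⟨q, hq1, hq3, hq2⟩
  have := closure_mono hsub hp'
  rw [hfin.isClosed.closure_eq] at this
  exact this.2

/-- For each `n`, a sequence of pairs of points of `F` at distance `< 1 / (n + 1)` such that the
`l`-th pair is not linked by any small `η n`-chain of length at most `l`. -/
structure UnlinkedPairs {X : Type u} [MetricSpace X] (F : Set X) (ρ : ℝ) (η : ℕ → ℝ)
    (x y : ℕ → ℕ → X) : Prop where
  radius_pos : 0 < ρ
  left_mem : ∀ n l, x n l ∈ F
  right_mem : ∀ n l, y n l ∈ F
  step_pos : ∀ n, 0 < η n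
  step_le : ∀ n : ℕ, η n ≤ 1 / (n + 1)
  dist_lt : ∀ n l : ℕ, dist (x n l) (y n l) < 1 / (n + 1)
  not_chainIn : ∀ n l, ∀ k ≤ l, ∀ p, ¬ ChainIn (ball p ρ) (η n) k (x n l) (y n l)

namespace UnlinkedPairs

variable {X : Type u} [MetricSpace X] {F : Set X} {ρ : ℝ} {η : ℕ → ℝ} {x y : ℕ → ℕ → X}
  {U : Filter ℕ}

/-- Many rows escape from every point at a common scale. One diagonal choice produces a separated D
that contains, for arbitrarily small pair distances, points `x n l` of one row with arbitrarily
large `l`. The partners `y n l` are then linked to D with bounded length, and separation forces the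
chain to end at `x n l`. -/
theorem false_of_unbounded (hB : UnlinkedPairs F ρ η x y)
    (h : IsLocallyChainConnectedAt (discreteHyperspace F)) [U.NeBot] (hU : U ≤ atTop)
    {r : ℝ} (hr : 0 < r) (hP : ∀ᶠ n in U, ∀ p, ∀ᶠ l in U, r ≤ dist (x n l) p) : False := by
  have ht : ∀ a, ∃ n ≥ a, ∀ p, ∀ᶠ l in U, r ≤ dist (x n l) p := fun a =>
    (((eventually_ge_atTop a).filter_mono hU).and hP).exists
  choose t hta ht using ht
  -- The index `s` codes a pair: the first entry selects the row, the second is a lower bound for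
  -- the position in it, so each selected row is visited infinitely often.
  obtain ⟨f, hf, hfr⟩ := exists_seq_of_forall_finset
    (fun s (q : ℕ × ℕ) => q.1 = t (Nat.unpair s).1 ∧ (Nat.unpair s).2 ≤ q.2)
    (fun q q' => r ≤ dist (x q'.1 q'.2) (x q.1 q.2)) (by
      intro s S
      have : ∀ᶠ l in U, ∀ q ∈ S, r ≤ dist (x (t (Nat.unpair s).1) l) (x q.1 q.2) :=
        (Filter.eventually_all_finset S).2 fun q _ => ht _ _
      obtain ⟨l, hl, hl'⟩ :=
        (((eventually_ge_atTop (Nat.unpair s).2).filter_mono hU).and this).exists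
      exact ⟨(_, l), ⟨rfl, hl⟩, hl'⟩)
  let z : ℕ → X := fun s => x (f s).1 (f s).2
  let w : ℕ → X := fun s => y (f s).1 (f s).2
  have hpw : (range z).Pairwise fun p q => r ≤ dist p q := by
    rintro _ ⟨s, rfl⟩ _ ⟨s', rfl⟩ hne
    rcases lt_trichotomy s s' with hs | rfl | hs
    · rw [dist_comm]; exact hfr _ _ hs
    · exact absurd rfl hne
    · exact hfr _ _ hs
  obtain ⟨D, hD, hDc⟩ := exists_mem_discreteHyperspace_of_pairwise (F := F)
    (range_subset_iff.2 fun s => hB.left_mem _ _) (range_nonempty z) (countable_range z) hr hpw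
  have hρ := hB.radius_pos
  have hε : 0 < min ρ (r / 3) := by positivity
  obtain ⟨δ, hδ, hG⟩ := h.exists_chainIn hD hε
  obtain ⟨a, ha⟩ := exists_nat_one_div_lt (show 0 < min δ (min ρ (r / 3)) by positivity)
  have han : 1 / ((t a : ℝ) + 1) ≤ 1 / ((a : ℝ) + 1) :=
    one_div_le_one_div_of_le (by positivity) (by exact_mod_cast Nat.succ_le_succ (hta a))
  have hn := han.trans_lt ha
  have hnδ := hn.trans_le (min_le_left _ _)
  have hnε := hn.trans_le (min_le_right _ _)
  obtain ⟨K, hK⟩ := hG (η (t a)) (hB.step_pos _) ((hB.step_le _).trans_lt hnδ)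
    (w '' {s | (Nat.unpair s).1 = a}) (image_subset_iff.2 fun s _ => hB.right_mem _ _)
    ((to_countable _).image w) (by
      rintro _ ⟨s, hs, rfl⟩
      refine ⟨z s, hDc ▸ mem_range_self s, ?_⟩
      rw [dist_comm]
      refine (hB.dist_lt _ _).trans ?_
      rwa [(hf s).1, show (Nat.unpair s).1 = a from hs])
  set s := Nat.pair a K with hsdef
  have hs1 : (Nat.unpair s).1 = a := by simp [hsdef]
  have hs2 : (Nat.unpair s).2 = K := by simp [hsdef]
  have hfs : (f s).1 = t a := by rw [(hf s).1, hs1]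
  obtain ⟨v, hv, hc⟩ := hK (w s) ⟨s, hs1, rfl⟩
  rw [hDc] at hv hc
  have hdz : dist (w s) (z s) < min ρ (r / 3) := by
    rw [dist_comm]
    refine (hB.dist_lt _ _).trans ?_
    rwa [hfs]
  have hstep : η (t a) ≤ r / 3 :=
    ((hB.step_le _).trans_lt hnε).le.trans (min_le_right _ _)
  have hmin : min ρ (r / 3) ≤ r / 3 := min_le_right _ _
  have := hc.ball_of_pairwise hpw (hB.step_pos _).le (by linarith) hv (mem_range_self s) hdz
  refine hB.not_chainIn (f s).1 (f s).2 K (hs2 ▸ (hf s).2) (z s) ?_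
  have hc' := this.symm.mono (ball_subset_ball (min_le_left ρ (r / 3))) le_rfl
  simp only [z, w, hfs] at hc' ⊢
  exact hc'

/-- Here whole rows concentrate near single points `z` of D. Both members of a pair are linked to
`z`, as separation excludes any other end, and the two chains are joined. -/
theorem false_of_near_pairwise (hB : UnlinkedPairs F ρ η x y)
    (h : IsLocallyChainConnectedAt (discreteHyperspace F)) [U.NeBot] (hU : U ≤ atTop)
    {D : Set X} (hDF : D ⊆ F) (hDc : D.Countable) {r : ℝ} (hr : 0 < r)
    (hpw : D.Pairwise fun p q => r ≤ dist p q)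
    (hD : ∀ σ > 0, ∃ n : ℕ, 1 / ((n : ℝ) + 1) < σ ∧ ∃ z ∈ D, ∀ᶠ l in U, dist (x n l) z < σ) :
    False := by
  have hne : D.Nonempty := by
    obtain ⟨n, -, z, hz, -⟩ := hD 1 one_pos
    exact ⟨z, hz⟩
  obtain ⟨D, hD', rfl⟩ := exists_mem_discreteHyperspace_of_pairwise hDF hne hDc hr hpw
  have hρ := hB.radius_pos
  have hε : 0 < min ρ (r / 3) := by positivity
  obtain ⟨δ, hδ, hG⟩ := h.exists_chainIn hD' hε
  obtain ⟨n, hn, z, hz, hxz⟩ := hD (min δ (min ρ (r / 3)) / 2) (by positivity)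
  have hσ1 : min δ (min ρ (r / 3)) ≤ δ := min_le_left _ _
  have hσ2 : min δ (min ρ (r / 3)) ≤ min ρ (r / 3) := min_le_right _ _
  set σ := min δ (min ρ (r / 3)) / 2 with hσ
  set V := {l | dist (x n l) z < σ} with hV
  have hx : ∀ l ∈ V, dist (x n l) z < σ := fun l hl => hl
  have hy : ∀ l ∈ V, dist (y n l) z < 2 * σ := fun l hl => by
    have h1 := hB.dist_lt n l
    have h2 := hx l hl
    have h3 := dist_triangle_left (y n l) z (x n l)
    linarith
  have hσ0 : 0 < σ := (by positivity : (0 : ℝ) < 1 / (n + 1)).trans hn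
  obtain ⟨K, hK⟩ := hG (η n) (hB.step_pos _) (by linarith [hB.step_le n]) (x n '' V ∪ y n '' V)
    (union_subset (image_subset_iff.2 fun s _ => hB.left_mem _ _)
      (image_subset_iff.2 fun s _ => hB.right_mem _ _))
    (((to_countable _).image _).union ((to_countable _).image _)) (by
      rintro _ (⟨l, hl, rfl⟩ | ⟨l, hl, rfl⟩)
      · exact ⟨z, hz, by linarith [hx l hl]⟩
      · exact ⟨z, hz, by linarith [hy l hl]⟩)
  obtain ⟨l, hl, hlV⟩ := (((eventually_ge_atTop (K + K)).filter_mono hU).and hxz).exists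
  have hmin : min ρ (r / 3) ≤ r / 3 := min_le_right _ _
  have hstep : 2 * min ρ (r / 3) + η n ≤ r := by linarith [hB.step_le n]
  obtain ⟨v, hv, hcx⟩ := hK (x n l) (Or.inl ⟨l, hlV, rfl⟩)
  obtain ⟨v', hv', hcy⟩ := hK (y n l) (Or.inr ⟨l, hlV, rfl⟩)
  have h1 := hcx.ball_of_pairwise hpw (hB.step_pos _).le hstep hv hz (by linarith [hx l hlV])
  have h2 := hcy.ball_of_pairwise hpw (hB.step_pos _).le hstep hv' hz (by linarith [hy l hlV])
  exact hB.not_chainIn n l (K + K) hl z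
    ((h1.trans h2.symm).mono (ball_subset_ball (min_le_left _ _)) le_rfl)

end UnlinkedPairs

theorem cauchySeq_of_dist_lt {X : Type*} [MetricSpace X] {a : ℕ → X}
    (ha : ∀ i j : ℕ, dist (a i) (a j) < 1 / ((i : ℝ) + 1) + 1 / ((j : ℝ) + 1)) : CauchySeq a := by
  refine Metric.cauchySeq_iff.2 fun ε hε => ?_
  obtain ⟨N, hN⟩ := exists_nat_one_div_lt (half_pos hε)
  have hle : ∀ m : ℕ, N ≤ m → 1 / ((m : ℝ) + 1) < ε / 2 := fun m hm =>
    (one_div_le_one_div_of_le (by positivity) (by exact_mod_cast Nat.succ_le_succ hm)).trans_lt hN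
  exact ⟨N, fun m hm n hn => by linarith [ha m n, hle m hm, hle n hn]⟩

theorem exists_mem_discreteHyperspace_image {X : Type u} [MetricSpace X] {F : Set X} {a : ℕ → X}
    (haF : ∀ j, a j ∈ F) (ha : CauchySeq a) (hlim : ∀ p, ¬ Tendsto a atTop (𝓝 p)) {J : Set ℕ}
    (hJ : J.Nonempty) : ∃ D ∈ discreteHyperspace F, D.carrier = a '' J :=
  exists_mem_discreteHyperspace (image_subset_iff.2 fun j _ => haF j) (hJ.image a)
    ((to_countable J).image a)
    (fun _ hT => isClosed_of_subset_range_of_cauchySeq ha hlim (hT.trans (image_subset_range a J)))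
    (Or.inl (ha.totallyBounded_range.subset (image_subset_range a J)))

/-- Along a non-convergent Cauchy sequence, all points are linked to finitely many of them. -/
theorem IsLocallyChainConnectedAt.exists_finite_links {X : Type u} [MetricSpace X] {F : Set X}
    (h : IsLocallyChainConnectedAt (discreteHyperspace F)) {a : ℕ → X} (haF : ∀ j, a j ∈ F)
    (ha : ∀ i j : ℕ, dist (a i) (a j) < 1 / ((i : ℝ) + 1) + 1 / ((j : ℝ) + 1))
    (hlim : ∀ p, ¬ Tendsto a atTop (𝓝 p)) {J : Set ℕ} (hJ : ∃ᶠ j in atTop, j ∈ J)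
    {ε : ℝ} (hε : 0 < ε) :
    ∃ N, ∀ η > 0, ∃ K, ∀ j ∈ J, ∃ p ∈ J, p ≤ N ∧
      ChainIn (thickening ε (a '' J)) η K (a j) (a p) := by
  have hac := cauchySeq_of_dist_lt ha
  have hJne : J.Nonempty := let ⟨j, hj⟩ := hJ.exists; ⟨j, hj⟩
  obtain ⟨D, hD, hDJ⟩ := exists_mem_discreteHyperspace_image haF hac hlim hJne
  obtain ⟨δ, hδ, hδ'⟩ := h D hD (min ε 1) (by positivity)
  obtain ⟨M, hM⟩ := exists_nat_one_div_lt (show 0 < δ / 4 by positivity)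
  obtain ⟨N, hMN, hN⟩ := (frequently_atTop.1 hJ) M
  have hle : ∀ m : ℕ, M ≤ m → 1 / ((m : ℝ) + 1) < δ / 4 := fun m hm =>
    (one_div_le_one_div_of_le (by positivity) (by exact_mod_cast Nat.succ_le_succ hm)).trans_lt hM
  -- A finite initial part of the sequence is already Hausdorff close to the whole, so `N` is fixed
  -- before the step size `η` is given.
  obtain ⟨E, hE, hEJ⟩ := exists_mem_discreteHyperspace_image haF hac hlim
    (J := J ∩ Iic N) ⟨N, hN, mem_Iic.2 le_rfl⟩
  have hED : dist E D < δ := by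
    refine (Hyperspace.dist_le_of_mem (r := δ / 2) (by positivity) (fun x hx => ?_)
      fun x hx => ?_).trans_lt (by linarith)
    · rw [hEJ] at hx
      exact ⟨x, hDJ ▸ image_mono inter_subset_left hx, by simpa using (half_pos hδ).le⟩
    · rw [hDJ] at hx
      obtain ⟨j, hj, rfl⟩ := hx
      rw [hEJ]
      rcases le_total j N with hjN | hjN
      · exact ⟨a j, ⟨j, ⟨hj, hjN⟩, rfl⟩, by simpa using (half_pos hδ).le⟩
      · exact ⟨a N, ⟨N, ⟨hN, mem_Iic.2 le_rfl⟩, rfl⟩, by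
          linarith [ha j N, hle j (hMN.trans hjN), hle N hMN]⟩
  refine ⟨N, fun η hη => ?_⟩
  obtain ⟨K, hK⟩ := hδ' (min η 1) (by positivity) E hE hED
  refine ⟨K, fun j hj => ?_⟩
  obtain ⟨z, hz, hc⟩ := hK.exists_chainIn (min_le_right _ _) (min_le_right _ _)
    (x := a j) (by rw [hDJ]; exact ⟨j, hj, rfl⟩)
  rw [hEJ] at hz
  obtain ⟨p, ⟨hp, hpN⟩, rfl⟩ := hz
  refine ⟨p, hp, hpN, hc.mono ?_ (min_le_left _ _)⟩
  rw [hDJ]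
  exact inter_subset_left.trans (thickening_mono (min_le_left _ _) _)

/-- Some infinite subfamily of a non-convergent Cauchy sequence consists of points which are
linked to a common point by chains with arbitrarily small steps. -/
theorem IsLocallyChainConnectedAt.exists_common_link {X : Type u} [MetricSpace X] {F : Set X}
    (h : IsLocallyChainConnectedAt (discreteHyperspace F)) {a : ℕ → X} (haF : ∀ j, a j ∈ F)
    (ha : ∀ i j : ℕ, dist (a i) (a j) < 1 / ((i : ℝ) + 1) + 1 / ((j : ℝ) + 1))
    (hlim : ∀ p, ¬ Tendsto a atTop (𝓝 p)) (j₀ : ℕ) {ε : ℝ} (hε : 0 < ε) :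
    ∃ (J : Set ℕ) (p : ℕ), J ⊆ Ici j₀ ∧ (∃ᶠ j in atTop, j ∈ J) ∧ ∀ j ∈ J, ∀ η > 0, ∃ K,
      ChainIn (thickening ε (a '' Ici j₀)) η K (a j) (a p) := by
  obtain ⟨N, hN⟩ := h.exists_finite_links haF ha hlim (J := Ici j₀)
    (eventually_ge_atTop j₀).frequently hε
  have key : ∀ j ∈ Ici j₀, ∃ p ∈ Finset.range (N + 1), ∀ η > 0, ∃ K,
      ChainIn (thickening ε (a '' Ici j₀)) η K (a j) (a p) := by
    intro j hj
    by_contra! hcon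
    -- Failure at one step size persists at smaller ones. With finitely many candidates `p`, one
    -- step size would defeat them all.
    have : ∀ᶠ η in 𝓝[>] (0 : ℝ), ∀ p ∈ Finset.range (N + 1), ∀ K,
        ¬ ChainIn (thickening ε (a '' Ici j₀)) η K (a j) (a p) := by
      refine (Filter.eventually_all_finset _).2 fun p hp => ?_
      obtain ⟨η, hη, hK⟩ := hcon p hp
      filter_upwards [Ioo_mem_nhdsGT hη] with θ hθ K hc
      exact hK K (hc.mono Subset.rfl hθ.2.le)
    obtain ⟨η, hη, hη0⟩ := (this.and self_mem_nhdsWithin).exists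
    obtain ⟨K, hK⟩ := hN η hη0
    obtain ⟨p, -, hpN, hc⟩ := hK j hj
    exact hη p (Finset.mem_range.2 (by omega)) K hc
  choose! p hpN hp using key
  have : ∃ q ∈ Finset.range (N + 1), ∃ᶠ j in atTop, j₀ ≤ j ∧ p j = q := by
    by_contra! hcon
    have := (Filter.eventually_all_finset _).2 hcon
    obtain ⟨j, hj, hj₀⟩ := (this.and (eventually_ge_atTop j₀)).exists
    exact hj _ (hpN j hj₀) hj₀ rfl
  obtain ⟨q, -, hq⟩ := this
  exact ⟨{j | j₀ ≤ j ∧ p j = q}, q, fun j hj => hj.1, hq, fun j hj => hj.2 ▸ hp j hj.1⟩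

/-- If the sequence converges, its limit alone serves as D. Otherwise pairs are linked to possibly
different terms of a subsequence `J`, whose points no separation keeps apart. These terms are linked
with uniform length to finitely many terms of `J`, and those to a common one, so the total length
stays bounded. -/
theorem UnlinkedPairs.false_of_near_cauchy {X : Type u} [MetricSpace X] {F : Set X} {ρ : ℝ}
    {η : ℕ → ℝ} {x y : ℕ → ℕ → X} {U : Filter ℕ} (hB : UnlinkedPairs F ρ η x y)
    (h : IsLocallyChainConnectedAt (discreteHyperspace F)) [U.NeBot] (hU : U ≤ atTop)
    (hF : IsClosed F) {a : ℕ → X} (haF : ∀ j, a j ∈ F)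
    (hxa : ∀ j : ℕ, ∀ᶠ n in U, ∀ᶠ l in U, dist (x n l) (a j) < 1 / ((j : ℝ) + 1)) : False := by
  have ha : ∀ i j : ℕ, dist (a i) (a j) < 1 / ((i : ℝ) + 1) + 1 / ((j : ℝ) + 1) := by
    intro i j
    obtain ⟨n, hi, hj⟩ := ((hxa i).and (hxa j)).exists
    obtain ⟨l, hi, hj⟩ := (hi.and hj).exists
    linarith [dist_triangle_left (a i) (a j) (x n l)]
  have hsmall : ∀ σ > 0, ∀ᶠ n : ℕ in U, 1 / ((n : ℝ) + 1) < σ := fun σ hσ =>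
    (tendsto_one_div_add_atTop_nhds_zero_nat.eventually_lt_const hσ).filter_mono hU
  by_cases hlim : ∃ p, Tendsto a atTop (𝓝 p)
  · obtain ⟨p, hp⟩ := hlim
    refine hB.false_of_near_pairwise h hU (D := {p})
      (singleton_subset_iff.2 (hF.mem_of_tendsto hp (Eventually.of_forall haF)))
      (countable_singleton p) one_pos (pairwise_singleton _ _) fun σ hσ => ?_
    obtain ⟨j, hj1, hj2⟩ := ((tendsto_one_div_add_atTop_nhds_zero_nat.eventually_lt_const
      (half_pos hσ)).and (Metric.tendsto_nhds.1 hp (σ / 2) (half_pos hσ))).exists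
    obtain ⟨n, hn1, hn2⟩ := ((hsmall σ hσ).and (hxa j)).exists
    refine ⟨n, hn1, p, rfl, hn2.mono fun l hl => ?_⟩
    linarith [dist_triangle (x n l) (a j) p]
  push Not at hlim
  have hρ := hB.radius_pos
  obtain ⟨j₀, hj₀⟩ := exists_nat_one_div_lt (show 0 < ρ / 4 by positivity)
  have hsub : thickening (ρ / 4) (a '' Ici j₀) ⊆ ball (a j₀) ρ := by
    intro q hq
    obtain ⟨_, ⟨j, hj, rfl⟩, hd⟩ := mem_thickening_iff.1 hq
    have : 1 / ((j : ℝ) + 1) ≤ 1 / ((j₀ : ℝ) + 1) :=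
      one_div_le_one_div_of_le (by positivity) (by exact_mod_cast Nat.succ_le_succ hj)
    rw [mem_ball]
    linarith [dist_triangle q (a j) (a j₀), ha j j₀]
  obtain ⟨J, p, hJ₀, hJ, hp⟩ := h.exists_common_link haF ha hlim j₀ (show 0 < ρ / 4 by positivity)
  have hsubJ : thickening (ρ / 4) (a '' J) ⊆ ball (a j₀) ρ :=
    (thickening_subset_of_subset _ (image_mono hJ₀)).trans hsub
  obtain ⟨N, hN⟩ := h.exists_finite_links haF ha hlim hJ (show 0 < ρ / 4 by positivity)
  obtain ⟨D, hD, hDJ⟩ := exists_mem_discreteHyperspace_image haF (cauchySeq_of_dist_lt ha) hlim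
    (let ⟨j, hj⟩ := hJ.exists; (⟨j, hj⟩ : J.Nonempty))
  obtain ⟨δ, hδ, hG⟩ := h.exists_chainIn hD (show 0 < ρ / 4 by positivity)
  obtain ⟨m, hmJ, hm⟩ := (hJ.and_eventually
    (tendsto_one_div_add_atTop_nhds_zero_nat.eventually_lt_const (half_pos hδ))).exists
  obtain ⟨n, hnδ, hxm⟩ := ((hsmall (δ / 2) (half_pos hδ)).and (hxa m)).exists
  set V := {l | dist (x n l) (a m) < 1 / ((m : ℝ) + 1)} with hV
  obtain ⟨K₁, hK₁⟩ := hG (η n) (hB.step_pos _) (by linarith [hB.step_le n]) (x n '' V ∪ y n '' V)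
    (union_subset (image_subset_iff.2 fun s _ => hB.left_mem _ _)
      (image_subset_iff.2 fun s _ => hB.right_mem _ _))
    (((to_countable _).image _).union ((to_countable _).image _)) (by
      rw [hDJ]
      rintro _ (⟨l, hl, rfl⟩ | ⟨l, hl, rfl⟩)
      · exact ⟨a m, ⟨m, hmJ, rfl⟩, by linarith [show dist (x n l) (a m) < _ from hl]⟩
      · refine ⟨a m, ⟨m, hmJ, rfl⟩, ?_⟩
        linarith [show dist (x n l) (a m) < _ from hl, hB.dist_lt n l,
          dist_triangle_left (y n l) (a m) (x n l)])
  obtain ⟨K₂, hK₂⟩ := hN (η n) (hB.step_pos n)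
  have hp' : ∀ j, ∃ K, j ∈ J → ChainIn (ball (a j₀) ρ) (η n) K (a j) (a p) := by
    intro j
    by_cases hj : j ∈ J
    · obtain ⟨K, hK⟩ := hp j hj (η n) (hB.step_pos n)
      exact ⟨K, fun _ => hK.mono hsub le_rfl⟩
    · exact ⟨0, fun h => absurd h hj⟩
  choose K' hK' using hp'
  set K₃ := (Finset.range (N + 1)).sup K'
  have hlink : ∀ s ∈ x n '' V ∪ y n '' V,
      ChainIn (ball (a j₀) ρ) (η n) (K₁ + (K₂ + K₃)) s (a p) := by
    intro s hs
    obtain ⟨z, hz, hc⟩ := hK₁ s hs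
    rw [hDJ] at hz hc
    obtain ⟨j, hj, rfl⟩ := hz
    obtain ⟨q, hq, hqN, hcq⟩ := hK₂ j hj
    refine (hc.mono hsubJ le_rfl).trans ((hcq.mono hsubJ le_rfl).trans ?_)
    exact (hK' q hq).length_mono (hB.step_pos n)
      (Finset.le_sup (f := K') (Finset.mem_range.2 (by omega)))
  obtain ⟨l, hl, hlV⟩ := (((eventually_ge_atTop (K₁ + (K₂ + K₃) + (K₁ + (K₂ + K₃)))).filter_mono
    hU).and hxm).exists
  exact hB.not_chainIn n l _ hl (a j₀)
    ((hlink _ (Or.inl ⟨l, hlV, rfl⟩)).trans (hlink _ (Or.inr ⟨l, hlV, rfl⟩)).symm)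

/-- An ultrafilter turns the alternatives into clean cases: rows escape from every point, or they
concentrate at every scale; in the latter case their centers either can be chosen separated or
accumulate at every scale. -/
theorem UnlinkedPairs.elim {X : Type u} [MetricSpace X] {F : Set X} {ρ : ℝ}
    {η : ℕ → ℝ} {x y : ℕ → ℕ → X} (hB : UnlinkedPairs F ρ η x y)
    (h : IsLocallyChainConnectedAt (discreteHyperspace F)) (hF : IsClosed F) : False := by
  let U : Ultrafilter ℕ := hyperfilter ℕ
  have hU : (U : Filter ℕ) ≤ atTop := Nat.hyperfilter_le_atTop
  have h1 : ∀ r > 0, ∀ᶠ n in (U : Filter ℕ), ∃ p, ∀ᶠ l in (U : Filter ℕ), dist (x n l) p < r := by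
    intro r hr
    by_contra hcon
    rw [← Ultrafilter.eventually_not] at hcon
    refine hB.false_of_unbounded h hU hr (hcon.mono fun n hn p => ?_)
    by_contra hp
    rw [← Ultrafilter.eventually_not] at hp
    exact hn ⟨p, hp.mono fun l hl => not_le.1 hl⟩
  by_cases h2 : ∃ r > 0, ∀ p, ∀ᶠ n in (U : Filter ℕ), ∀ᶠ l in (U : Filter ℕ), r ≤ dist (x n l) p
  · obtain ⟨r, hr, h2⟩ := h2
    obtain ⟨f, hf, hfr⟩ := exists_seq_of_forall_finset
      (fun s (q : ℕ × X) => q.2 ∈ F ∧ s ≤ q.1 ∧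
        ∀ᶠ l in (U : Filter ℕ), dist (x q.1 l) q.2 < 1 / ((s : ℝ) + 1))
      (fun q q' => r ≤ dist q'.2 q.2) (by
        intro s S
        have hS : ∀ᶠ n in (U : Filter ℕ), ∀ q ∈ S, ∀ᶠ l in (U : Filter ℕ),
            r ≤ dist (x n l) q.2 := (Filter.eventually_all_finset S).2 fun q _ => h2 _
        obtain ⟨n, hn, ⟨p, hp⟩, hs⟩ := (hS.and ((h1 (1 / ((s : ℝ) + 1) / 2)
          (by positivity)).and ((eventually_ge_atTop s).filter_mono hU))).exists
        obtain ⟨l, hl, hlp⟩ := (((Filter.eventually_all_finset S).2 hn).and hp).exists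
        refine ⟨(n, x n l), ⟨hB.left_mem _ _, hs, hp.mono fun m hm => ?_⟩, hl⟩
        dsimp only
        linarith [dist_triangle_right (x n m) (x n l) p])
    refine hB.false_of_near_pairwise h hU (D := range fun s => (f s).2)
      (range_subset_iff.2 fun s => (hf s).1) (countable_range _) hr ?_ fun σ hσ => ?_
    · rintro _ ⟨s, rfl⟩ _ ⟨s', rfl⟩ hne
      rcases lt_trichotomy s s' with hs | rfl | hs
      · rw [dist_comm]; exact hfr _ _ hs
      · exact absurd rfl hne
      · exact hfr _ _ hs
    · obtain ⟨s, hs⟩ := exists_nat_one_div_lt hσ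
      refine ⟨(f s).1, lt_of_le_of_lt ?_ hs, (f s).2, mem_range_self s,
        (hf s).2.2.mono fun l hl => hl.trans hs⟩
      exact one_div_le_one_div_of_le (by positivity)
        (by exact_mod_cast Nat.succ_le_succ (hf s).2.1)
  · push Not at h2
    have h3 : ∀ j : ℕ, ∃ p ∈ F, ∀ᶠ n in (U : Filter ℕ), ∀ᶠ l in (U : Filter ℕ),
        dist (x n l) p < 1 / ((j : ℝ) + 1) := by
      intro j
      obtain ⟨p, hp⟩ := h2 (1 / ((j : ℝ) + 1) / 2) (by positivity)
      obtain ⟨n, hn⟩ := hp.exists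
      obtain ⟨l, hl⟩ := hn.exists
      refine ⟨x n l, hB.left_mem _ _, hp.mono fun n' hn' => hn'.mono fun l' hl' => ?_⟩
      linarith [dist_triangle_right (x n' l') (x n l) p]
    choose a haF ha using h3
    exact hB.false_of_near_cauchy h hU hF haF ha

theorem IsLocallyChainConnectedAt.isUniformlyLocallyChainEquiConnectedAt {X : Type u}
    [MetricSpace X] {F : Set X} (hF : IsClosed F)
    (h : IsLocallyChainConnectedAt (discreteHyperspace F)) :
    IsUniformlyLocallyChainEquiConnectedAt F := by
  by_contra hcon
  unfold IsUniformlyLocallyChainEquiConnectedAt at hcon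
  push Not at hcon
  obtain ⟨ε, hε, hcon⟩ := hcon
  have h1 : ∀ n : ℕ, ∃ η > 0, η ≤ 1 / ((n : ℝ) + 1) ∧ ∀ L : ℕ, ∃ x ∈ F, ∃ y ∈ F,
      dist x y < 1 / ((n : ℝ) + 1) ∧ ∀ l ≤ L, ¬ LinkedByChain η ε l x y := by
    intro n
    obtain ⟨η, hη, hL⟩ := hcon (1 / ((n : ℝ) + 1)) (by positivity)
    -- Shrinking `η` only removes chains, and makes the step sizes tend to zero with the distances
    -- of the pairs.
    refine ⟨min η (1 / ((n : ℝ) + 1)), by positivity, min_le_right _ _, fun L => ?_⟩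
    obtain ⟨x, hx, y, hy, hxy, hl⟩ := hL L
    refine ⟨x, hx, y, hy, hxy, fun l hlL hc => hl l hlL ?_⟩
    obtain ⟨c, c0, c1, c2, c3⟩ := hc
    exact ⟨c, c0, c1, fun i hi => (c2 i hi).trans_le (min_le_left _ _), c3⟩
  choose η hη hη1 x hx y hy hxy hl using h1
  exact UnlinkedPairs.elim (F := F) (ρ := ε / 3) (η := η) (x := x) (y := y)
    ⟨by positivity, hx, hy, hη, hη1, hxy, fun n l k hk p hc =>
      hl n l k hk (hc.linkedByChain_of_ball (by linarith))⟩ h hF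

/-! ### From equi-bounded chains to traces with a common modulus -/

theorem exists_seq_of_invariant {α : Type*} (I : Finset α → Prop) (P : ℕ → α → Prop)
    [DecidableEq α] {S₀ : Finset α} (h₀ : I S₀)
    (h : ∀ n (S : Finset α), I S → ∃ y, P n y ∧ I (insert y S)) :
    ∃ f : ℕ → α, (∀ n, P n (f n)) ∧ ∀ n, ∃ S, I S ∧ S₀ ⊆ S ∧ ∀ m < n, f m ∈ S := by
  have h' : ∀ n (S : {S : Finset α // I S}), ∃ y, P n y ∧ I (insert y S.1) :=
    fun n S => h n S.1 S.2
  choose g hgP hgI using h'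
  let S : ℕ → {S : Finset α // I S} := fun n => Nat.rec ⟨S₀, h₀⟩ (fun n s => ⟨_, hgI n s⟩) n
  have hS : ∀ n, (S (n + 1)).1 = insert (g n (S n)) (S n).1 := fun n => rfl
  have hmono : Monotone fun n => (S n).1 := monotone_nat_of_le_succ fun n => by
    rw [hS]; exact Finset.subset_insert _ _
  refine ⟨fun n => g n (S n), fun n => hgP n _, fun n => ⟨(S n).1, (S n).2, ?_, fun m hm => ?_⟩⟩
  · exact hmono (Nat.zero_le n)
  · exact hmono (Nat.succ_le_of_lt hm) (show _ ∈ (S (m + 1)).1 by rw [hS]; exact Finset.mem_insert_self _ _)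

/-- A finite partial map with strict Lipschitz bound 2 extends to one more point: the admissible
values fill a nonempty open interval, which meets `Q₀`. The constant 2 makes the initial map fixing
both ends strict. -/
theorem exists_lipschitz_map_into_dense {s : ℝ} (hs : 0 < s) {Q Q₀ : Set ℝ} (hQ : Q.Countable)
    (hQs : Q ⊆ Icc 0 s) (hQ₀ : ∀ a b, 0 ≤ a → a < b → b ≤ s → ∃ q ∈ Q₀, a < q ∧ q < b)
    (h0 : (0 : ℝ) ∈ Q₀) (hs0 : s ∈ Q₀) (hQ0 : (0 : ℝ) ∈ Q) (hQs' : s ∈ Q) :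
    ∃ φ : Q → ℝ, (∀ q, φ q ∈ Q₀) ∧ φ ⟨0, hQ0⟩ = 0 ∧ φ ⟨s, hQs'⟩ = s ∧
      ∀ q q' : Q, |φ q - φ q'| ≤ 2 * |(q : ℝ) - q'| := by
  classical
  let I : Finset (ℝ × ℝ) → Prop := fun S => S.Nonempty ∧ (∀ a ∈ S, a.2 ∈ Q₀ ∧ a.2 ∈ Icc 0 s) ∧
    ∀ a ∈ S, ∀ b ∈ S, a = b ∨ |a.2 - b.2| < 2 * |a.1 - b.1|
  have hI₀ : I {(0, 0), (s, s)} := by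
    refine ⟨by simp, ?_, ?_⟩
    · simp [h0, hs0, hs.le]
    · have : |s| < 2 * |s| := by rw [abs_of_pos hs]; linarith
      simp [this]
  obtain ⟨e, he⟩ := hQ.exists_eq_range ⟨0, hQ0⟩
  have heQ : ∀ n, e n ∈ Icc 0 s := fun n => hQs (he ▸ mem_range_self n)
  obtain ⟨f, hf, hfI⟩ := exists_seq_of_invariant I (fun n p => p.1 = e n) hI₀ (by
    rintro n S ⟨hne, hS0, hS⟩
    by_cases hmem : ∃ a ∈ S, a.1 = e n
    · obtain ⟨a, ha, hae⟩ := hmem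
      exact ⟨a, hae, by rw [Finset.insert_eq_of_mem ha]; exact ⟨hne, hS0, hS⟩⟩
    push Not at hmem
    have hpos : ∀ a ∈ S, 0 < |e n - a.1| := fun a ha =>
      abs_pos.2 (sub_ne_zero.2 (hmem a ha).symm)
    obtain ⟨a, ha, hamax⟩ := S.exists_max_image (fun a => a.2 - 2 * |e n - a.1|) hne
    obtain ⟨b, hb, hbmin⟩ := S.exists_min_image (fun a => a.2 + 2 * |e n - a.1|) hne
    have hab : a.2 - 2 * |e n - a.1| < b.2 + 2 * |e n - b.1| := by
      rcases hS a ha b hb with rfl | h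
      · linarith [hpos a ha]
      · have h1 := (abs_lt.1 h).2
        have h2 : |a.1 - b.1| ≤ |e n - a.1| + |e n - b.1| := by
          rw [abs_sub_comm (e n) a.1]; exact abs_sub_le _ _ _
        linarith
    have ha2 := (hS0 a ha).2
    have hb2 := (hS0 b hb).2
    obtain ⟨v, hv, hv1, hv2⟩ := hQ₀ (max 0 (a.2 - 2 * |e n - a.1|))
      (min s (b.2 + 2 * |e n - b.1|)) (le_max_left _ _)
      (max_lt (lt_min hs (by linarith [hb2.1, hpos b hb]))
        (lt_min (by linarith [ha2.2, hpos a ha]) hab)) (min_le_left _ _)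
    obtain ⟨hv1, hv3⟩ := max_lt_iff.1 hv1
    obtain ⟨hv2, hv4⟩ := lt_min_iff.1 hv2
    have hvS : ∀ c ∈ S, |v - c.2| < 2 * |e n - c.1| := fun c hc => by
      have h1 := hamax c hc
      have h2 := hbmin c hc
      rw [abs_lt]
      constructor <;> linarith
    refine ⟨(e n, v), rfl, Finset.insert_nonempty _ _, fun c hc => ?_, fun c hc d hd => ?_⟩
    · rcases Finset.mem_insert.1 hc with rfl | hc
      · exact ⟨hv, hv1.le, hv2.le⟩
      · exact hS0 c hc
    · rcases Finset.mem_insert.1 hc with rfl | hc <;> rcases Finset.mem_insert.1 hd with rfl | hd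
      · exact Or.inl rfl
      · exact Or.inr (hvS d hd)
      · refine Or.inr ?_
        rw [abs_sub_comm, abs_sub_comm c.1]
        exact hvS c hc
      · exact hS c hc d hd)
  have hidx : ∀ q : Q, ∃ n, e n = q := fun q => he.subset q.2
  choose i hi using hidx
  have hle : ∀ a b : ℝ × ℝ, (a = b ∨ |a.2 - b.2| < 2 * |a.1 - b.1|) →
      |a.2 - b.2| ≤ 2 * |a.1 - b.1| := by
    rintro a b (rfl | h)
    · simp
    · exact h.le
  have hend : ∀ q : Q, ((q : ℝ), (q : ℝ)) ∈ ({(0, 0), (s, s)} : Finset (ℝ × ℝ)) →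
      (f (i q)).2 = q := by
    intro q hq
    obtain ⟨S, hS, hsub, hm⟩ := hfI (i q + 1)
    have := hle _ _ (hS.2.2 _ (hm _ (Nat.lt_succ_self _)) _ (hsub hq))
    rw [hf, hi] at this
    simpa [sub_eq_zero] using this
  refine ⟨fun q => (f (i q)).2, fun q => ?_, hend ⟨0, hQ0⟩ (by simp), hend ⟨s, hQs'⟩ (by simp),
    fun q q' => ?_⟩
  · obtain ⟨S, hS, -, hm⟩ := hfI (i q + 1)
    exact (hS.2.1 _ (hm _ (Nat.lt_succ_self _))).1
  · obtain ⟨S, hS, -, hm⟩ := hfI (max (i q) (i q') + 1)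
    have := hle _ _ (hS.2.2 _ (hm (i q) (Nat.lt_succ_of_le (le_max_left _ _))) _
      (hm (i q') (Nat.lt_succ_of_le (le_max_right _ _))))
    rwa [hf, hf, hi, hi] at this

/-- The supremum of the admissible `v` is monotone in `t` and small for small `t`; adding `t` makes
it positive. -/
theorem exists_isContinuityModulus {γ e : ℕ → ℝ} (hγ : ∀ j, 0 < γ j) (he : ∀ j, 0 ≤ e j)
    (he0 : Tendsto e atTop (𝓝 0)) : ∃ ω, IsContinuityModulus ω ∧ ∀ t > 0, ∀ v, 0 ≤ v → v ≤ e 0 →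
      (∀ j, t ≤ γ j → v ≤ e j) → v ≤ ω t := by
  let S : ℝ → Set ℝ := fun t => {v | 0 ≤ v ∧ v ≤ e 0 ∧ ∀ j, t ≤ γ j → v ≤ e j}
  have hbdd : ∀ t, BddAbove (S t) := fun t => ⟨e 0, fun v hv => hv.2.1⟩
  have h0 : ∀ t, (0 : ℝ) ∈ S t := fun t => ⟨le_rfl, he 0, fun j _ => he j⟩
  have hnn : ∀ t, 0 ≤ sSup (S t) := fun t => le_csSup (hbdd t) (h0 t)
  refine ⟨fun t => t + sSup (S t), ⟨fun t ht => by linarith [hnn t], fun t ht t' ht' htt' => ?_, ?_⟩,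
    fun t ht v hv hv0 hvj => ?_⟩
  · exact add_le_add htt' (csSup_le_csSup (hbdd _) ⟨0, h0 _⟩ fun v hv =>
      ⟨hv.1, hv.2.1, fun j hj => hv.2.2 j (htt'.trans hj)⟩)
  · rw [Metric.tendsto_nhdsWithin_nhds]
    intro ε hε
    obtain ⟨j, hj⟩ := (he0.eventually_lt_const (half_pos hε)).exists
    refine ⟨min (γ j) (ε / 2), lt_min (hγ j) (half_pos hε), fun {t} ht htd => ?_⟩
    have ht0 : 0 < t := ht
    rw [Real.dist_eq, sub_zero, abs_of_pos ht0] at htd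
    obtain ⟨ht1, ht2⟩ := lt_min_iff.1 htd
    have : sSup (S t) ≤ e j := csSup_le ⟨0, h0 t⟩ fun v hv => hv.2.2 j ht1.le
    rw [Real.dist_eq, sub_zero, abs_of_nonneg (by linarith [hnn t])]
    linarith
  · exact (le_csSup (hbdd t) ⟨hv, hv0, hvj⟩).trans (by linarith)

theorem IsUniformlyLocallyChainEquiConnectedAt.exists_refinement {X : Type u} [MetricSpace X]
    {G : Set X} (h : IsUniformlyLocallyChainEquiConnectedAt G) {ε : ℕ → ℝ} (hε : ∀ k, 0 < ε k) :
    ∃ (δ : ℕ → ℝ) (N : ℕ → ℕ), (∀ k, 0 < δ k) ∧ (∀ k, δ k ≤ ε k) ∧ Antitone δ ∧ (∀ k, 2 ≤ N k) ∧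
      ∀ k, ∀ u ∈ G, ∀ v ∈ G, dist u v < δ k → ChainIn (ball u (ε k)) (δ (k + 1)) (N k) u v := by
  choose d hd hd' using fun k => h (ε k) (hε k)
  let δ : ℕ → ℝ := fun k => Nat.rec (min (d 0) (ε 0))
    (fun k t => min t (min (d (k + 1)) (ε (k + 1)))) k
  have hδs : ∀ k, δ (k + 1) = min (δ k) (min (d (k + 1)) (ε (k + 1))) := fun k => rfl
  have hδle : ∀ k, δ k ≤ min (d k) (ε k) := by
    rintro (_ | k)
    · exact le_rfl
    · rw [hδs]; exact min_le_right _ _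
  have hδ0 : ∀ k, 0 < δ k := by
    intro k
    induction k with
    | zero => exact lt_min (hd 0) (hε 0)
    | succ k ih => rw [hδs]; exact lt_min ih (lt_min (hd _) (hε _))
  -- The length bound at level `k` depends on the next scale, so all scales are fixed first. Padding
  -- then gives every chain of one level the same length.
  choose L hL using fun k => hd' k (δ (k + 1)) (hδ0 (k + 1))
  refine ⟨δ, fun k => L k + 2, hδ0, fun k => (hδle k).trans (min_le_right _ _),
    antitone_nat_of_succ_le fun k => by rw [hδs]; exact min_le_left _ _, fun k => by dsimp only; omega,
    fun k u hu v hv huv => ?_⟩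
  obtain ⟨l, hl, hc⟩ := hL k u hu v hv (huv.trans_le ((hδle k).trans (min_le_left _ _)))
  exact hc.chainIn.length_mono (hδ0 (k + 1)) (by dsimp only; omega)

/-- Successive refinement of a pair of points by chains of prescribed lengths. -/
theorem exists_nested_chains {X : Type u} [MetricSpace X] {G : Set X} {ε δ : ℕ → ℝ} {N : ℕ → ℕ}
    (hδε : ∀ k, δ k ≤ ε k) (hε2 : ∀ k, ε (k + 1) = ε k / 2) (hε0 : ∀ k, 0 < ε k)
    (hN : ∀ k, 2 ≤ N k)
    (href : ∀ k, ∀ u ∈ G, ∀ v ∈ G, dist u v < δ k →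
      ChainIn (ball u (ε k)) (δ (k + 1)) (N k) u v)
    {k : ℕ} {x y : X} (hxy : dist x y < δ k) (hG : ball x (3 * ε k) ⊆ G) :
    ∃ g : ℕ → ℕ → X, (∀ n, g n 0 = x) ∧ (∀ n, g n (∏ m ∈ Finset.range n, N (k + m)) = y) ∧
      (∀ n, ∀ i < ∏ m ∈ Finset.range n, N (k + m), dist (g n i) (g n (i + 1)) < δ (k + n)) ∧
      (∀ n i, g (n + 1) (N (k + n) * i) = g n i) ∧
      ∀ n, ∀ i ≤ ∏ m ∈ Finset.range (n + 1), N (k + m),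
        dist (g (n + 1) i) (g n (i / N (k + n))) < ε (k + n) := by
  -- The start of the chain is prescribed unconditionally, so that nesting of the levels holds
  -- before membership in `G` is known.
  have hC : ∀ m u v, ∃ c : ℕ → X, c 0 = u ∧ (u ∈ G → v ∈ G → dist u v < δ m →
      c (N m) = v ∧ (∀ i < N m, dist (c i) (c (i + 1)) < δ (m + 1)) ∧
      ∀ i ≤ N m, dist (c i) u < ε m) := by
    intro m u v
    by_cases hh : u ∈ G ∧ v ∈ G ∧ dist u v < δ m
    · obtain ⟨c, c0, c1, c2, c3⟩ := href m u hh.1 v hh.2.1 hh.2.2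
      exact ⟨c, c0, fun _ _ _ => ⟨c1, c2, c3⟩⟩
    · exact ⟨fun _ => u, rfl, fun h1 h2 h3 => absurd ⟨h1, h2, h3⟩ hh⟩
  choose C C0 C1 using hC
  let g : ℕ → ℕ → X := fun n => Nat.rec (fun i => if i = 0 then x else y)
    (fun n gn i => C (k + n) (gn (i / N (k + n))) (gn (i / N (k + n) + 1)) (i % N (k + n))) n
  have hg0 : ∀ i, g 0 i = if i = 0 then x else y := fun i => rfl
  have hgs : ∀ n i, g (n + 1) i =
      C (k + n) (g n (i / N (k + n))) (g n (i / N (k + n) + 1)) (i % N (k + n)) := fun n i => rfl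
  have hNpos : ∀ m, 0 < N m := fun m => by have := hN m; omega
  set P : ℕ → ℕ := fun n => ∏ m ∈ Finset.range n, N (k + m) with hP
  have hPs : ∀ n, P (n + 1) = P n * N (k + n) := fun n => Finset.prod_range_succ _ _
  have hmul : ∀ n i, g (n + 1) (N (k + n) * i) = g n i := by
    intro n i
    rw [hgs, Nat.mul_div_cancel_left _ (hNpos _), Nat.mul_mod_right, C0]
  have hx : ∀ n, g n 0 = x := by
    intro n
    induction n with
    | zero => simp [hg0]
    | succ n ih => simpa [ih] using hmul n 0
  have hy : ∀ n, g n (P n) = y := by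
    intro n
    induction n with
    | zero => simp [hg0, hP]
    | succ n ih => rw [hPs, mul_comm, hmul, ih]
  -- Since `ε` halves, level `n` adds exactly `ε (k + n) = 2 * ε (k + n) - 2 * ε (k + n + 1)`; the
  -- bound stays below `3 * ε k`, hence inside `G`.
  have main : ∀ n, (∀ i ≤ P n, dist (g n i) x ≤ 3 * ε k - 2 * ε (k + n)) ∧
      ∀ i < P n, dist (g n i) (g n (i + 1)) < δ (k + n) := by
    intro n
    induction n with
    | zero =>
      have := hε0 k
      refine ⟨fun i hi => ?_, fun i hi => ?_⟩
      · rw [hg0]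
        split_ifs
        · simp; linarith
        · rw [dist_comm]; simp only [add_zero]; linarith [hδε k]
      · obtain rfl : i = 0 := by simpa [hP] using hi
        simpa [hg0] using hxy
    | succ n ih =>
      obtain ⟨ih1, ih2⟩ := ih
      have hmem : ∀ i ≤ P n, g n i ∈ G := fun i hi =>
        hG (mem_ball.2 ((ih1 i hi).trans_lt (by linarith [hε0 (k + n)])))
      have hchain : ∀ q < P n, _ := fun q hq => C1 (k + n) (g n q) (g n (q + 1)) (hmem q hq.le)
        (hmem (q + 1) hq) (ih2 q hq)
      have hdiv : ∀ i < P (n + 1), i / N (k + n) < P n := fun i hi => by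
        rw [Nat.div_lt_iff_lt_mul (hNpos _)]; rwa [hPs] at hi
      have hε' := hε2 (k + n)
      refine ⟨fun i hi => ?_, fun i hi => ?_⟩
      · rcases hi.lt_or_eq with hi | rfl
        · have h1 := (hchain _ (hdiv i hi)).2.2 (i % N (k + n)) (Nat.mod_lt _ (hNpos _)).le
          have h2 := ih1 _ (hdiv i hi).le
          rw [← hgs] at h1
          have h3 := dist_triangle (g (n + 1) i) (g n (i / N (k + n))) x
          rw [← add_assoc]
          linarith
        · rw [hPs, mul_comm, hmul]
          have := ih1 _ le_rfl
          rw [← add_assoc]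
          linarith [hε0 (k + n)]
      · obtain ⟨-, hc2, -⟩ := hchain _ (hdiv i hi)
        have hc := hchain _ (hdiv i hi)
        have hlt := Nat.mod_lt i (hNpos (k + n))
        have hdm := Nat.div_add_mod i (N (k + n))
        have h1 := hc.2.1 _ hlt
        rw [← hgs] at h1
        suffices g (n + 1) (i + 1) = C (k + n) (g n (i / N (k + n))) (g n (i / N (k + n) + 1))
            (i % N (k + n) + 1) by rw [this]; exact h1
        rcases Nat.lt_or_ge (i % N (k + n) + 1) (N (k + n)) with hr | hr
        · have hi' : i + 1 = (i % N (k + n) + 1) + N (k + n) * (i / N (k + n)) := by omega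
          have e1 : (i + 1) / N (k + n) = i / N (k + n) := by
            rw [hi', Nat.add_mul_div_left _ _ (hNpos _), Nat.div_eq_of_lt hr, zero_add]
          have e2 : (i + 1) % N (k + n) = i % N (k + n) + 1 := by
            rw [hi', Nat.add_mul_mod_self_left, Nat.mod_eq_of_lt hr]
          rw [hgs, e1, e2]
        · have hr' : i % N (k + n) + 1 = N (k + n) := by omega
          have hi' : i + 1 = N (k + n) * (i / N (k + n) + 1) := by rw [mul_add, mul_one]; omega
          rw [hr', hi', hmul, hc.1]
  refine ⟨g, hx, hy, fun n => (main n).2, hmul, fun n i hi => ?_⟩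
  obtain ⟨h1, h2⟩ := main n
  rcases (show i ≤ P (n + 1) from hi).lt_or_eq with hi | rfl
  · have hq : i / N (k + n) < P n := by
      rw [Nat.div_lt_iff_lt_mul (hNpos _)]; rwa [hPs] at hi
    have hmem : ∀ i ≤ P n, g n i ∈ G := fun i hi =>
      hG (mem_ball.2 ((h1 i hi).trans_lt (by linarith [hε0 (k + n)])))
    exact (C1 (k + n) (g n _) (g n _) (hmem _ hq.le) (hmem _ hq) (h2 _ hq)).2.2 _
      (Nat.mod_lt _ (hNpos _)).le
  · rw [hPs, mul_comm, hmul, Nat.mul_div_cancel_left _ (hNpos _), dist_self]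
    exact hε0 _

/-- A nested family of chains defines a map on a dense subset of an interval. -/
theorem exists_trace_of_nested_chains {X : Type u} [MetricSpace X] {ε δ : ℕ → ℝ} {N : ℕ → ℕ}
    (hδε : ∀ k, δ k ≤ ε k) (hε2 : ∀ k, ε (k + 1) = ε k / 2) (hε0 : ∀ k, 0 < ε k)
    (hN : ∀ k, 2 ≤ N k) {k : ℕ} {x y : X} {g : ℕ → ℕ → X} (hx : ∀ n, g n 0 = x)
    (hy : ∀ n, g n (∏ m ∈ Finset.range n, N (k + m)) = y)
    (hstep : ∀ n, ∀ i < ∏ m ∈ Finset.range n, N (k + m), dist (g n i) (g n (i + 1)) < δ (k + n))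
    (hmul : ∀ n i, g (n + 1) (N (k + n) * i) = g n i)
    (hnear : ∀ n, ∀ i ≤ ∏ m ∈ Finset.range (n + 1), N (k + m),
        dist (g (n + 1) i) (g n (i / N (k + n))) < ε (k + n)) {s : ℝ} (hs : 0 < s) :
    ∃ (Q : Set ℝ) (f : ℝ → X), Q ⊆ Icc 0 s ∧ 0 ∈ Q ∧ s ∈ Q ∧
      (∀ a b, 0 ≤ a → a < b → b ≤ s → ∃ q ∈ Q, a < q ∧ q < b) ∧ f 0 = x ∧ f s = y ∧
      ∀ n : ℕ, ∀ t ∈ Q, ∀ t' ∈ Q, |t - t'| ≤ s / (∏ m ∈ Finset.range n, N (k + m) : ℕ) →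
        dist (f t) (f t') ≤ 5 * ε (k + n) := by
  have hNpos : ∀ m, 0 < N m := fun m => by have := hN m; omega
  set P : ℕ → ℕ := fun n => ∏ m ∈ Finset.range n, N (k + m) with hP
  have hPs : ∀ n, P (n + 1) = P n * N (k + n) := fun n => Finset.prod_range_succ _ _
  have hPpos : ∀ n, 0 < P n := fun n => Finset.prod_pos fun m _ => hNpos _
  have hPn : ∀ n, n ≤ P n := by
    intro n
    induction n with
    | zero => exact Nat.zero_le _
    | succ n ih =>
      rw [hPs]
      have := Nat.mul_le_mul_left (P n) (hN (k + n))
      have := hPpos n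
      omega
  let F : ℕ → ℝ → X := fun n t => g n ⌊t * P n / s⌋₊
  have hfl : ∀ n, ∀ t ∈ Icc 0 s, ⌊t * P n / s⌋₊ ≤ P n := fun n t ht => by
    refine Nat.floor_le_of_le ?_
    rw [div_le_iff₀ hs, mul_comm]
    exact mul_le_mul_of_nonneg_left ht.2 (Nat.cast_nonneg _)
  have hF1 : ∀ n, ∀ t ∈ Icc 0 s, dist (F (n + 1) t) (F n t) < ε (k + n) := by
    intro n t ht
    have h1 := hnear n _ (hfl (n + 1) t ht)
    rw [← Nat.floor_div_natCast] at h1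
    have hNr : (N (k + n) : ℝ) ≠ 0 := by exact_mod_cast (hNpos _).ne'
    rwa [show t * (P (n + 1) : ℕ) / s / (N (k + n) : ℝ) = t * P n / s by
      rw [hPs]; push_cast; field_simp] at h1
  have hF2 : ∀ n m, ∀ t ∈ Icc 0 s,
      dist (F (n + m) t) (F n t) ≤ 2 * ε (k + n) - 2 * ε (k + n + m) := by
    intro n m t ht
    induction m with
    | zero => simp
    | succ m ih =>
      have h1 := hF1 (n + m) t ht
      have h2 := hε2 (k + n + m)
      rw [← add_assoc] at h1
      have h3 := dist_triangle (F (n + m + 1) t) (F (n + m) t) (F n t)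
      rw [← add_assoc, ← add_assoc]
      linarith
  -- The space may be incomplete, so the limit is taken only where the approximations stabilize;
  -- this includes all nodes of the subdivisions.
  let Q : Set ℝ := {t | t ∈ Icc 0 s ∧ ∃ p n, ∀ m ≥ n, F m t = p}
  have hint : ∀ n t, (∃ i : ℕ, t * P n / s = i) → ∀ m,
      (∃ i : ℕ, t * P (n + m) / s = i) ∧ F (n + m) t = F n t := by
    intro n t hi m
    induction m with
    | zero => exact ⟨hi, rfl⟩
    | succ m ih =>
      obtain ⟨⟨i, hi⟩, ih⟩ := ih
      have h1 : t * P (n + (m + 1)) / s = (N (k + (n + m)) * i : ℕ) := by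
        rw [← add_assoc, hPs]
        push_cast
        rw [← hi]
        ring
      refine ⟨⟨_, h1⟩, ?_⟩
      rw [← ih]
      simp only [F]
      rw [h1, hi, Nat.floor_natCast, Nat.floor_natCast, ← add_assoc, hmul]
  have hQint : ∀ n, ∀ t ∈ Icc 0 s, (∃ i : ℕ, t * P n / s = i) → t ∈ Q := by
    intro n t ht hi
    refine ⟨ht, F n t, n, fun m hm => ?_⟩
    obtain ⟨m, rfl⟩ := Nat.exists_eq_add_of_le hm
    exact (hint n t hi m).2
  have : Nonempty X := ⟨x⟩
  choose! f hf using fun t (ht : t ∈ Q) => ht.2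
  have hfF : ∀ n, ∀ t ∈ Q, dist (f t) (F n t) ≤ 2 * ε (k + n) := by
    intro n t ht
    obtain ⟨m, hm⟩ := hf t ht
    have h1 := hF2 n m t ht.1
    rw [hm (n + m) (Nat.le_add_left _ _)] at h1
    linarith [hε0 (k + n + m)]
  have h0Q : (0 : ℝ) ∈ Q := hQint 0 0 ⟨le_rfl, hs.le⟩ ⟨0, by simp⟩
  have hsQ : s ∈ Q := hQint 0 s ⟨hs.le, le_rfl⟩ ⟨P 0, by field_simp⟩
  refine ⟨Q, f, fun t ht => ht.1, h0Q, hsQ, fun a b ha hab hb => ?_, ?_, ?_, fun n t ht t' ht' htt' => ?_⟩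
  · obtain ⟨n, hn⟩ := exists_nat_gt (s / (b - a))
    have hPr : (0 : ℝ) < P n := by exact_mod_cast hPpos n
    have hsP : s / P n < b - a := by
      rw [div_lt_iff₀ hPr, mul_comm, ← div_lt_iff₀ (by linarith)]
      exact hn.trans_le (by exact_mod_cast hPn n)
    have h1 := Nat.lt_floor_add_one (a * P n / s)
    have h2 := Nat.floor_le (show 0 ≤ a * P n / s by positivity)
    set i := ⌊a * P n / s⌋₊
    have h3 : a < (i + 1 : ℝ) * (s / P n) := by
      rw [div_lt_iff₀ hs] at h1
      rw [← mul_div_assoc, lt_div_iff₀ hPr]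
      exact h1
    have h4 : (i + 1 : ℝ) * (s / P n) < b := by
      rw [le_div_iff₀ hs] at h2
      have : (i : ℝ) * (s / P n) ≤ a := by
        rw [← mul_div_assoc, div_le_iff₀ hPr]
        exact h2
      linarith
    refine ⟨(i + 1 : ℝ) * (s / P n), hQint n _ ⟨(ha.trans_lt h3).le, (h4.trans_le hb).le⟩
      ⟨i + 1, ?_⟩, h3, h4⟩
    push_cast
    field_simp
  · obtain ⟨m, hm⟩ := hf 0 h0Q
    rw [← hm m le_rfl]
    simp [F, hx]
  · obtain ⟨m, hm⟩ := hf s hsQ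
    rw [← hm m le_rfl]
    simp only [F]
    rw [mul_comm, mul_div_assoc, div_self hs.ne', mul_one, Nat.floor_natCast]
    exact hy m
  · wlog hle : t ≤ t' generalizing t t'
    · rw [dist_comm]
      exact this t' ht' t ht (by rwa [abs_sub_comm]) (le_of_not_ge hle)
    have h1 := hfF n t ht
    have h2 := hfF n t' ht'
    have hPr : (0 : ℝ) < P n := by exact_mod_cast hPpos n
    have h3 : dist (F n t) (F n t') ≤ ε (k + n) := by
      have hb : t' * P n / s ≤ t * P n / s + 1 := by
        rw [abs_sub_comm, abs_of_nonneg (by linarith), le_div_iff₀ hPr] at htt'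
        rw [div_add_one hs.ne']
        exact div_le_div_of_nonneg_right (by linarith) hs.le
      have ha : t * P n / s ≤ t' * P n / s :=
        div_le_div_of_nonneg_right (mul_le_mul_of_nonneg_right hle hPr.le) hs.le
      have hi1 := Nat.floor_mono ha
      have hi2 := Nat.floor_mono hb
      rw [Nat.floor_add_one (div_nonneg (mul_nonneg ht.1.1 hPr.le) hs.le)] at hi2
      have hi3 := hfl n t' ht'.1
      simp only [F]
      rcases hi1.eq_or_lt with h | h
      · rw [h, dist_self]; exact (hε0 _).le
      · have h' : ⌊t' * P n / s⌋₊ = ⌊t * P n / s⌋₊ + 1 := by omega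
        rw [h']
        exact ((hstep n _ (by simp only [hP] at *; omega)).trans_le (hδε _)).le
    -- The constant is 5 = 2 + 1 + 2: two approximation errors and at most one step of the chain.
    have := dist_triangle4 (f t) (F n t) (F n t') (f t')
    rw [dist_comm (f t')] at h2
    linarith

theorem IsUniformlyLocallyTraceEquiConnectedAt.of_chain {X : Type u} [MetricSpace X] {F : Set X}
    {r : ℝ} (hr : 0 < r) (h : IsUniformlyLocallyChainEquiConnectedAt (cthickening r F)) :
    IsUniformlyLocallyTraceEquiConnectedAt F := by
  let ε : ℕ → ℝ := fun k => r / 3 * (1 / 2) ^ k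
  have hε0 : ∀ k, 0 < ε k := fun k => by positivity
  have hε2 : ∀ k, ε (k + 1) = ε k / 2 := fun k => by simp only [ε, pow_succ]; ring
  have hεa : Antitone ε := antitone_nat_of_succ_le fun k => by
    rw [hε2]; linarith [hε0 k]
  have hεr : ∀ k, 3 * ε k ≤ r := fun k => by
    have := hεa (Nat.zero_le k)
    have h0 : ε 0 = r / 3 := by simp [ε]
    linarith
  have hεt : Tendsto ε atTop (𝓝 0) := by
    have := (tendsto_pow_atTop_nhds_zero_of_lt_one (r := (1 / 2 : ℝ)) (by norm_num)
      (by norm_num)).const_mul (r / 3)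
    simpa only [mul_zero] using this
  obtain ⟨δ, N, hδ0, hδε, hδa, hN, href⟩ := h.exists_refinement hε0
  have hNpos : ∀ m, 0 < N m := fun m => by have := hN m; omega
  have hPpos : ∀ n, (0 : ℝ) < (∏ m ∈ Finset.range n, N m : ℕ) := fun n => by
    exact_mod_cast Finset.prod_pos fun m _ => hNpos _
  -- The mesh at error level `j` is `s` over the product of the lengths from level `k` on, where `δ
  -- (k + 1) ≤ s`. For `j > k`, this `γ j` is a lower bound that depends on neither `s` nor `k`.
  let γ : ℕ → ℝ := fun j => δ (j + 1) / (∏ m ∈ Finset.range j, N m : ℕ)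
  have hγ : ∀ j, 0 < γ j := fun j => div_pos (hδ0 _) (hPpos j)
  obtain ⟨ω, hω, hωv⟩ := exists_isContinuityModulus (γ := fun j => γ j / 2)
    (e := fun j => 5 * ε j) (fun j => half_pos (hγ j)) (fun j => by linarith [hε0 j])
    (by simpa using hεt.const_mul 5)
  refine ⟨δ 0, hδ0 0, ω, hω, fun x hx y hy hxy Q h0 h1 hQc hQs _ => ?_⟩
  rcases eq_or_ne x y with rfl | hne
  · refine ⟨fun _ => x, uniformContinuous_const, rfl, rfl, fun t _ => ?_⟩
    simp [continuityModulus]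
  have hs : 0 < dist x y := dist_pos.2 hne
  set s := dist x y with hsdef
  have hex : ∃ k, δ (k + 1) ≤ s := by
    obtain ⟨k, hk⟩ := (hεt.eventually_lt_const hs).exists
    exact ⟨k, (hδa (Nat.le_succ k)).trans ((hδε k).trans hk.le)⟩
  classical
  obtain ⟨k, hk1, hk2⟩ : ∃ k, s < δ k ∧ δ (k + 1) ≤ s := by
    refine ⟨Nat.find hex, ?_, Nat.find_spec hex⟩
    rcases hk : Nat.find hex with _ | k
    · exact hxy
    · exact not_le.1 (Nat.find_min hex (by omega))
  have hball : ball x (3 * ε k) ⊆ cthickening r F := by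
    refine (ball_subset_thickening hx _).trans ((thickening_mono (hεr k) _).trans ?_)
    exact thickening_subset_cthickening _ _
  obtain ⟨g, hg0, hg1, hgs, hgm, hgn⟩ := exists_nested_chains hδε hε2 hε0 hN href hk1 hball
  obtain ⟨Q₀, f, hQ₀s, hf0, hfs, hfd, hfx, hfy, hfω⟩ :=
    exists_trace_of_nested_chains hδε hε2 hε0 hN hg0 hg1 hgs hgm hgn hs
  have hmod : ∀ j : ℕ, ∀ t ∈ Q₀, ∀ t' ∈ Q₀, |t - t'| ≤ s → |t - t'| ≤ γ j ∨ j = 0 →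
      dist (f t) (f t') ≤ 5 * ε j := by
    intro j t ht t' ht' hts htj
    -- For `j ≤ k` the whole trace already has oscillation at most `5 * ε k ≤ 5 * ε j`.
    rcases le_or_gt j k with hjk | hjk
    · have := hfω 0 t ht t' ht' (by simpa using hts)
      have h2 := hεa hjk
      simp only [add_zero] at this
      linarith
    · obtain ⟨n, rfl⟩ := Nat.exists_eq_add_of_lt hjk
      have htj := htj.resolve_right (by omega)
      rw [show k + n + 1 = k + (n + 1) by ring] at *
      refine hfω (n + 1) t ht t' ht' (htj.trans ?_)
      refine div_le_div₀ hs.le ((hδa (by omega)).trans hk2)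
        (by exact_mod_cast Finset.prod_pos fun m _ => hNpos _) ?_
      rw [Finset.prod_range_add N k (n + 1)]
      exact_mod_cast Nat.le_mul_of_pos_left _ (Finset.prod_pos fun m _ => hNpos _)
  obtain ⟨φ, hφQ, hφ0, hφs, hφl⟩ :=
    exists_lipschitz_map_into_dense hs hQc hQs hfd hf0 hfs h0 h1
  have key : ∀ q q' : Q, ∀ t > 0, dist q q' ≤ t → dist (f (φ q)) (f (φ q')) ≤ ω t := by
    intro q q' t ht hqt
    have hφs' : |φ q - φ q'| ≤ s := by
      have h1 := hQ₀s (hφQ q)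
      have h2 := hQ₀s (hφQ q')
      rw [abs_le]
      constructor <;> linarith [h1.1, h1.2, h2.1, h2.2]
    refine hωv t ht _ dist_nonneg (hmod 0 _ (hφQ q) _ (hφQ q') hφs' (Or.inr rfl)) fun j htj =>
      hmod j _ (hφQ q) _ (hφQ q') hφs' (Or.inl ?_)
    have := hφl q q'
    rw [Subtype.dist_eq, Real.dist_eq] at hqt
    linarith
  refine ⟨fun q => f (φ q), Metric.uniformContinuous_iff.2 fun e he => ?_, by simp [hφ0, hfx],
    (congrArg f hφs).trans hfy, fun t ht => ?_⟩
  · obtain ⟨t, ht, ht0⟩ :=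
      ((hω.tendsto_zero.eventually_lt_const he).and self_mem_nhdsWithin).exists
    exact ⟨t, ht0, fun q q' hqt => (key q q' t ht0 hqt.le).trans_lt ht⟩
  · refine iSup_le fun q => iSup_le fun q' => iSup_le fun hqt => ?_
    rw [edist_dist]
    exact ENNReal.ofReal_le_ofReal (key q q' t ht hqt)

/-! ### Growing sets and the Dugundji-type retraction -/

/-- A continuous increasing family of sets, growing from `A` to a superset of `B` inside of the
`e`-neighborhood of `A`. -/
structure IsGrowth {X : Type u} [MetricSpace X] (A B : Set X) (e : ℝ) (Γ : ℝ → Set X) : Prop where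
  eq_of_nonpos : ∀ τ ≤ 0, Γ τ = A
  subset_of_one_le : ∀ τ ≥ 1, B ⊆ Γ τ
  base_subset : ∀ τ, A ⊆ Γ τ
  subset_thickening : ∀ τ, Γ τ ⊆ thickening e A
  continuous : ∀ τ₀, ∀ ε > 0, ∀ᶠ τ in 𝓝 τ₀, Γ τ ⊆ thickening ε (Γ τ₀) ∧ Γ τ₀ ⊆ thickening ε (Γ τ)

theorem IsGrowth.mono {X : Type u} [MetricSpace X] {A B : Set X} {e e' : ℝ} {Γ : ℝ → Set X}
    (h : IsGrowth A B e Γ) (he : e ≤ e') : IsGrowth A B e' Γ :=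
  ⟨h.1, h.2, h.3, fun τ => (h.4 τ).trans (thickening_mono he _), h.5⟩

/-- One growth, chosen before `e`, competes with all others up to `κ`. Growths between anchors can
thus be fixed once and are still small wherever small ones exist. -/
theorem exists_nearly_optimal_growth {X : Type u} [MetricSpace X] (A B : Set X) {κ : ℝ}
    (hκ : 0 < κ) : ∃ Γ : ℝ → Set X, ∀ e > 0, (∃ Γ', IsGrowth A B e Γ') →
      IsGrowth A B (e + κ) Γ := by
  let S : Set ℝ := {e | 0 < e ∧ ∃ Γ', IsGrowth A B e Γ'}
  rcases S.eq_empty_or_nonempty with hS | hS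
  · exact ⟨fun _ => A, fun e he h => absurd (show e ∈ S from ⟨he, h⟩) (by simp [hS])⟩
  · obtain ⟨e₁, ⟨-, Γ, hΓ⟩, he₁⟩ := exists_lt_of_csInf_lt hS (lt_add_of_pos_right (sInf S) hκ)
    refine ⟨Γ, fun e he h => hΓ.mono (he₁.le.trans ?_)⟩
    have : sInf S ≤ e := csInf_le ⟨0, fun x hx => hx.1.le⟩ ⟨he, h⟩
    linarith

/-- The rational points of `[0, s]`, together with `s`. -/
def ratIcc (s : ℝ) : Set ℝ := Icc 0 s ∩ insert s (range ((↑) : ℚ → ℝ))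

theorem ratIcc_countable (s : ℝ) : (ratIcc s).Countable :=
  ((countable_range _).insert s).mono inter_subset_right

theorem zero_mem_ratIcc {s : ℝ} (hs : 0 ≤ s) : 0 ∈ ratIcc s :=
  ⟨⟨le_rfl, hs⟩, Or.inr ⟨0, by simp⟩⟩

theorem self_mem_ratIcc {s : ℝ} (hs : 0 ≤ s) : s ∈ ratIcc s := ⟨⟨hs, le_rfl⟩, Or.inl rfl⟩

theorem Icc_subset_closure_ratIcc {s : ℝ} (hs : 0 ≤ s) : Icc 0 s ⊆ closure (ratIcc s) := by
  rcases hs.eq_or_lt with rfl | hs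
  · rw [Icc_self]
    exact singleton_subset_iff.2 (subset_closure (zero_mem_ratIcc le_rfl))
  · rw [← closure_Ioo hs.ne]
    refine closure_minimal ?_ isClosed_closure
    refine (Rat.denseRange_cast.open_subset_closure_inter isOpen_Ioo).trans (closure_mono ?_)
    exact inter_subset_inter Ioo_subset_Icc_self (subset_insert _ _)

theorem IsUniformlyLocallyTraceEquiConnectedAt.exists_growth {X : Type u} [MetricSpace X]
    {G : Set X} (h : IsUniformlyLocallyTraceEquiConnectedAt G) {e : ℝ} (he : 0 < e) :
    ∃ σ > 0, ∀ A ⊆ G, ∀ B ⊆ G, (∀ b ∈ B, ∃ a ∈ A, dist a b < σ) → ∃ Γ, IsGrowth A B e Γ := by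
  obtain ⟨ε₀, hε₀, ω, hω, hf⟩ := h
  have hωlt : ∀ ε > 0, ∃ t > 0, ω t < ε := fun ε hε =>
    let ⟨t, ht, ht0⟩ := ((hω.tendsto_zero.eventually_lt_const hε).and self_mem_nhdsWithin).exists
    ⟨t, ht0, ht⟩
  obtain ⟨t₀, ht₀, hωt₀⟩ := hωlt e he
  have hσ : 0 < min ε₀ (min t₀ 1) := by positivity
  have hσ1 : min ε₀ (min t₀ 1) ≤ ε₀ := min_le_left _ _
  have hσ2 : min ε₀ (min t₀ 1) ≤ t₀ := (min_le_right _ _).trans (min_le_left _ _)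
  have hσ3 : min ε₀ (min t₀ 1) ≤ 1 := (min_le_right _ _).trans (min_le_right _ _)
  set σ := min ε₀ (min t₀ 1)
  have hpath : ∀ a b : X, ∃ p : ℝ → X, a ∈ G → b ∈ G → dist a b < σ → p 0 = a ∧ p (dist a b) = b ∧
      ∀ q ∈ ratIcc (dist a b), ∀ q' ∈ ratIcc (dist a b), ∀ t > 0, |q - q'| ≤ t →
        dist (p q) (p q') ≤ ω t := by
    intro a b
    by_cases hab : a ∈ G ∧ b ∈ G ∧ dist a b < σ
    · obtain ⟨f, -, hf0, hf1, hfω⟩ := hf a hab.1 b hab.2.1 (hab.2.2.trans_le hσ1)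
        (ratIcc (dist a b)) (zero_mem_ratIcc dist_nonneg) (self_mem_ratIcc dist_nonneg)
        (ratIcc_countable _) inter_subset_left (Icc_subset_closure_ratIcc dist_nonneg)
      classical
      refine ⟨fun q => if hq : q ∈ ratIcc (dist a b) then f ⟨q, hq⟩ else a, fun _ _ _ =>
        ⟨?_, ?_, fun q hq q' hq' t ht hqt => ?_⟩⟩
      · simp [zero_mem_ratIcc dist_nonneg, hf0]
      · simp [self_mem_ratIcc dist_nonneg, hf1]
      · simp only [dif_pos hq, dif_pos hq']
        rw [← ENNReal.ofReal_le_ofReal_iff (hω.pos t ht).le, ← edist_dist]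
        refine le_trans ?_ (hfω t ht)
        exact le_iSup_of_le _ (le_iSup_of_le _ (le_iSup_of_le
          (by rwa [Subtype.dist_eq, Real.dist_eq]) le_rfl))
    · exact ⟨fun _ => a, fun h1 h2 h3 => absurd ⟨h1, h2, h3⟩ hab⟩
  choose p hp using hpath
  refine ⟨σ, hσ, fun A hA B hB hAB => ?_⟩
  -- All traces run simultaneously, each up to the fraction `τ` of its length. Their common modulus
  -- gives Hausdorff continuity; `σ ≤ 1` bounds the change of time by that of `τ`.
  let Γ : ℝ → Set X := fun τ => A ∪ {z | ∃ a ∈ A, ∃ b ∈ B, dist a b < σ ∧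
    ∃ q ∈ ratIcc (dist a b), q ≤ τ * dist a b ∧ z = p a b q}
  have hcont : ∀ ε > 0, ∃ t > 0, ∀ τ τ', |τ - τ'| < t → Γ τ ⊆ thickening ε (Γ τ') := by
    intro ε hε
    obtain ⟨t, ht, hωt⟩ := hωlt ε hε
    refine ⟨t / 2, half_pos ht, fun τ τ' hτ z hz => ?_⟩
    rcases hz with hz | ⟨a, ha, b, hb, hab, q, hq, hqτ, rfl⟩
    · exact self_subset_thickening hε _ (Or.inl hz)
    obtain ⟨hp0, hp1, hpω⟩ := hp a b (hA ha) (hB hb) hab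
    set s := dist a b
    by_cases hqτ' : q ≤ τ' * s
    · exact self_subset_thickening hε _ (Or.inr ⟨a, ha, b, hb, hab, q, hq, hqτ', rfl⟩)
    push Not at hqτ'
    have hs1 : s ≤ 1 := hab.le.trans hσ3
    have hq0 : 0 ≤ q := hq.1.1
    have hqs : q ≤ s := hq.1.2
    have hs0 : 0 ≤ s := dist_nonneg
    have hττ : (τ - τ') * s < t / 2 := by
      have h1 := (abs_lt.1 hτ).2
      nlinarith
    rcases le_or_gt (τ' * s) 0 with hτ0 | hτ0
    · rw [mem_thickening_iff]
      refine ⟨a, Or.inl ha, lt_of_le_of_lt ?_ hωt⟩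
      nth_rewrite 2 [← hp0]
      refine hpω q hq 0 (zero_mem_ratIcc hs0) t ht ?_
      rw [sub_zero, abs_of_nonneg hq0]
      by_contra hcon
      push Not at hcon
      nlinarith
    · obtain ⟨q', hq'1, hq'2⟩ := exists_rat_btwn (max_lt hτ0
        (show τ' * s - t / 2 < τ' * s by linarith))
      obtain ⟨hq'3, hq'4⟩ := max_lt_iff.1 hq'1
      have hq' : (q' : ℝ) ∈ ratIcc s := ⟨⟨hq'3.le, by linarith⟩, Or.inr ⟨q', rfl⟩⟩
      rw [mem_thickening_iff]
      refine ⟨p a b q', Or.inr ⟨a, ha, b, hb, hab, q', hq', hq'2.le, rfl⟩, lt_of_le_of_lt ?_ hωt⟩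
      refine hpω q hq q' hq' t ht ?_
      rw [abs_of_nonneg (by linarith)]
      linarith
  refine ⟨Γ, fun τ hτ => ?_, fun τ hτ b hb => ?_, fun τ => subset_union_left, fun τ z hz => ?_,
    fun τ₀ ε hε => ?_⟩
  · refine union_eq_left.2 ?_
    rintro _ ⟨a, ha, b, hb, hab, q, hq, hqτ, rfl⟩
    have : q = 0 := le_antisymm (hqτ.trans (mul_nonpos_of_nonpos_of_nonneg hτ dist_nonneg)) hq.1.1
    rwa [this, (hp a b (hA ha) (hB hb) hab).1]
  · obtain ⟨a, ha, hab⟩ := hAB b hb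
    exact Or.inr ⟨a, ha, b, hb, hab, dist a b, self_mem_ratIcc dist_nonneg,
      le_mul_of_one_le_left dist_nonneg hτ, (hp a b (hA ha) (hB hb) hab).2.1.symm⟩
  · rcases hz with hz | ⟨a, ha, b, hb, hab, q, hq, hqτ, rfl⟩
    · exact self_subset_thickening he _ hz
    obtain ⟨hp0, hp1, hpω⟩ := hp a b (hA ha) (hB hb) hab
    rw [mem_thickening_iff]
    refine ⟨a, ha, lt_of_le_of_lt ?_ hωt₀⟩
    nth_rewrite 2 [← hp0]
    refine hpω q hq 0 (zero_mem_ratIcc dist_nonneg) t₀ ht₀ ?_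
    rw [sub_zero, abs_of_nonneg hq.1.1]
    exact hq.1.2.trans (hab.le.trans hσ2)
  · obtain ⟨t, ht, hΓ⟩ := hcont ε hε
    filter_upwards [ball_mem_nhds τ₀ ht] with τ hτ
    rw [mem_ball, Real.dist_eq] at hτ
    exact ⟨hΓ _ _ hτ, hΓ _ _ (by rwa [abs_sub_comm])⟩

/-- The union of the sets `Γ l k τ` where `l` is dominating at `m` and the time `τ` depends on the
weights of `l` and `k` at `m`. -/
def growthUnion {X W ι : Type*} (f : ι → W → ℝ) (Γ : ι → ι → ℝ → Set X) (m : W) : Set X :=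
  {z | ∃ l, 2 / 3 ≤ f l m ∧ ∃ k, 0 < f k m ∧ z ∈ Γ l k (min (3 * f k m - 1) (3 * f l m - 2))}

/-- The times are tuned so that index sets change without jumps. A `k` of weight at most 1/3 adds
nothing to the base set, and an `l` of weight 2/3, about to be dropped, contributes only its base
set, already covered by the growth from `p` towards it. -/
theorem eventually_growthUnion_subset {X : Type u} [MetricSpace X] {W ι : Type*}
    [TopologicalSpace W] {f : ι → W → ℝ} (hf : ∀ l, Continuous (f l)) (hf0 : ∀ l m, 0 ≤ f l m)
    {A : ι → Set X} {Γ : ι → ι → ℝ → Set X} {I : Finset ι} {m₀ : W}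
    (hI : ∀ᶠ m in 𝓝 m₀, ∀ l, f l m ≠ 0 → l ∈ I) {e : ℝ}
    (hΓ : ∀ l ∈ I, ∀ k ∈ I, IsGrowth (A l) (A k) e (Γ l k)) {p : ι} (hp : f p m₀ = 1)
    {ε : ℝ} (hε : 0 < ε) :
    ∀ᶠ m in 𝓝 m₀, growthUnion f Γ m ⊆ thickening ε (growthUnion f Γ m₀) ∧
      growthUnion f Γ m₀ ⊆ thickening ε (growthUnion f Γ m) := by
  have hI₀ : ∀ l, f l m₀ ≠ 0 → l ∈ I := hI.self_of_nhds
  have hτ : ∀ l k, Tendsto (fun m => min (3 * f k m - 1) (3 * f l m - 2)) (𝓝 m₀)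
      (𝓝 (min (3 * f k m₀ - 1) (3 * f l m₀ - 2))) := fun l k =>
    Continuous.tendsto (by have := hf l; have := hf k; fun_prop) m₀
  have hcont : ∀ᶠ m in 𝓝 m₀, ∀ l ∈ I, ∀ k ∈ I,
      Γ l k (min (3 * f k m - 1) (3 * f l m - 2)) ⊆
        thickening ε (Γ l k (min (3 * f k m₀ - 1) (3 * f l m₀ - 2))) ∧
      Γ l k (min (3 * f k m₀ - 1) (3 * f l m₀ - 2)) ⊆
        thickening ε (Γ l k (min (3 * f k m - 1) (3 * f l m - 2))) :=
    (Filter.eventually_all_finset I).2 fun l hl => (Filter.eventually_all_finset I).2 fun k hk =>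
      (hτ l k).eventually ((hΓ l hl k hk).continuous _ ε hε)
  have hlt : ∀ᶠ m in 𝓝 m₀, ∀ l ∈ I, f l m₀ < 2 / 3 → f l m < 2 / 3 :=
    (Filter.eventually_all_finset I).2 fun l _ => by
      by_cases h : f l m₀ < 2 / 3
      · exact ((hf l).continuousAt.eventually_lt_const h).mono fun m hm _ => hm
      · exact Eventually.of_forall fun m h' => absurd h' h
  have hgt : ∀ c : ℝ, ∀ᶠ m in 𝓝 m₀, ∀ l ∈ I, c < f l m₀ → c < f l m := fun c =>
    (Filter.eventually_all_finset I).2 fun l _ => by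
      by_cases h : c < f l m₀
      · exact ((hf l).continuousAt.eventually_const_lt h).mono fun m hm _ => hm
      · exact Eventually.of_forall fun m h' => absurd h' h
  filter_upwards [hI, hcont, hlt, hgt (2 / 3), hgt 0] with m hmI hm hmlt hmgt hmpos
  refine ⟨?_, ?_⟩
  · rintro z ⟨l, hl, k, hk, hz⟩
    have hlI := hmI l (by linarith)
    have hkI := hmI k hk.ne'
    have hl₀ : 2 / 3 ≤ f l m₀ := by
      by_contra hcon
      exact absurd (hmlt l hlI (not_le.1 hcon)) (not_lt.2 hl)
    refine thickening_subset_of_subset ε ?_ ((hm l hlI k hkI).1 hz)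
    rcases (hf0 k m₀).eq_or_lt with hk0 | hk0
    · rw [(hΓ l hlI k hkI).eq_of_nonpos _ ((min_le_left _ _).trans (by linarith))]
      exact fun w hw => ⟨l, hl₀, l, by linarith, (hΓ l hlI l hlI).base_subset _ hw⟩
    · exact fun w hw => ⟨l, hl₀, k, hk0, hw⟩
  · rintro z ⟨l, hl, k, hk, hz⟩
    have hlI := hI₀ l (by linarith)
    have hkI := hI₀ k hk.ne'
    rcases hl.eq_or_lt with hl | hl
    · have hpI := hI₀ p (by rw [hp]; exact one_ne_zero)
      rw [(hΓ l hlI k hkI).eq_of_nonpos _ ((min_le_right _ _).trans (by linarith))] at hz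
      have hz' := (hm p hpI l hlI).2 ((hΓ p hpI l hlI).subset_of_one_le _
        (le_min (by linarith) (by linarith)) hz)
      refine thickening_subset_of_subset ε ?_ hz'
      exact fun w hw => ⟨p, (hmgt p hpI (by linarith)).le, l, hmpos l hlI (by linarith), hw⟩
    · refine thickening_subset_of_subset ε ?_ ((hm l hlI k hkI).2 hz)
      exact fun w hw => ⟨l, (hmgt l hlI hl).le, k, hmpos k hkI hk, hw⟩

theorem exists_growth_near {X : Type u} [MetricSpace X] {H : Set (Hyperspace X)} (hH : IsOpen H)
    (h : ∀ F ∈ H, IsUniformlyLocallyTraceEquiConnectedAt F.carrier) {F : Hyperspace X}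
    (hF : F ∈ H) {e : ℝ} (he : 0 < e) : ∃ σ > 0, ∀ A B : Hyperspace X, dist A F < σ →
      dist B F < σ → ∃ Γ, IsGrowth A.carrier B.carrier e Γ := by
  obtain ⟨r, hr, hr1, -, hG⟩ := Hyperspace.exists_cthicken_mem hH hF
  obtain ⟨σ, hσ, hσ'⟩ := (h _ hG).exists_growth he
  have hsub : ∀ A : Hyperspace X, dist A F < r → A.carrier ⊆ (Hyperspace.cthicken r F).carrier :=
    fun A hA x hx => by
      obtain ⟨y, hy, hxy⟩ := Hyperspace.exists_dist_lt hA hr1 hx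
      exact thickening_subset_cthickening _ _ (mem_thickening_iff.2 ⟨y, hy, hxy⟩)
  have h1 : min r (σ / 2) ≤ r := min_le_left _ _
  have h2 : min r (σ / 2) ≤ σ / 2 := min_le_right _ _
  refine ⟨min r (σ / 2), by positivity, fun A B hA hB => hσ' _ (hsub A (hA.trans_le h1)) _
    (hsub B (hB.trans_le h1)) fun b hb => ?_⟩
  obtain ⟨c, hc, hbc⟩ := Hyperspace.exists_dist_lt hB (h1.trans hr1) hb
  obtain ⟨a, ha, hca⟩ := Hyperspace.exists_dist_lt (by rwa [dist_comm] at hA) (h1.trans hr1) hc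
  refine ⟨a, ha, ?_⟩
  rw [dist_comm] at hbc hca
  linarith [dist_triangle a c b]

/-- A Dugundji system for a closed subset `Y`: bump functions on the complement with anchors
in `Y`. -/
theorem exists_dugundji_system {M : Type u} [MetricSpace M] {Y : Set M} (hY : IsClosed Y)
    (hne : Y.Nonempty) : ∃ (f : (Yᶜ : Set M) → (Yᶜ : Set M) → ℝ) (a : (Yᶜ : Set M) → Y),
      (∀ l, Continuous (f l)) ∧ (∀ l m, 0 ≤ f l m) ∧ (∀ m, ∃ l, f l m = 1) ∧
      (LocallyFinite fun l => Function.support (f l)) ∧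
      ∀ (y : Y) (l m : (Yᶜ : Set M)), f l m ≠ 0 →
        dist (a l : M) y ≤ 4 * dist (m : M) y ∧ infDist (l : M) Y ≤ 2 * dist (m : M) y := by
  have hpos : ∀ w : (Yᶜ : Set M), 0 < infDist (w : M) Y := fun w =>
    (hY.notMem_iff_infDist_pos hne).1 w.2
  obtain ⟨f, hf⟩ := BumpCovering.exists_isSubordinate (X := (Yᶜ : Set M)) isClosed_univ
    (fun w => ball w (infDist (w : M) Y / 4)) (fun w => isOpen_ball)
    (fun w _ => mem_iUnion.2 ⟨w, mem_ball_self (by have := hpos w; positivity)⟩)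
  have ha : ∀ w : (Yᶜ : Set M), ∃ y : Y, dist (w : M) y < 2 * infDist (w : M) Y := fun w => by
    obtain ⟨y, hy, hd⟩ := (infDist_lt_iff hne).1
      (show infDist (w : M) Y < 2 * infDist (w : M) Y by linarith [hpos w])
    exact ⟨⟨y, hy⟩, hd⟩
  choose a ha using ha
  refine ⟨fun l => f l, a, fun l => (f l).continuous, fun l m => f.nonneg l m, fun m => ?_,
    f.locallyFinite, fun y l m hlm => ?_⟩
  · obtain ⟨l, hl⟩ := f.eventuallyEq_one' m (mem_univ m)
    exact ⟨l, hl.self_of_nhds⟩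
  · have h1 : dist m l < infDist (l : M) Y / 4 := hf l (subset_tsupport _ hlm)
    rw [Subtype.dist_eq] at h1
    have h2 : infDist (m : M) Y ≤ dist (m : M) y := infDist_le_dist_of_mem y.2
    have h3 : infDist (l : M) Y ≤ infDist (m : M) Y + dist (l : M) m :=
      infDist_le_infDist_add_dist
    rw [dist_comm] at h3
    have h4 := dist_triangle (a l : M) l y
    have h5 := dist_triangle (l : M) m y
    rw [dist_comm (l : M) m] at h5
    have h6 := ha l
    rw [dist_comm] at h6
    have h7 : 0 ≤ dist (m : M) y := dist_nonneg
    constructor <;> linarith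

/-- Near the image of F all relevant anchors are close to F and their growths are small, so the
united sets tend to F. Away from the image, continuity comes from local finiteness and the tuned
times. -/
theorem isANR_of_trace {X : Type u} [MetricSpace X] {H : Set (Hyperspace X)} (hH : IsOpen H)
    (h : ∀ F ∈ H, IsUniformlyLocallyTraceEquiConnectedAt F.carrier) : IsANR H := by
  classical
  intro M _ i hi hY
  rcases H.eq_empty_or_nonempty with hemp | ⟨F₀, hF₀⟩
  · have : IsEmpty H := by rw [hemp]; infer_instance
    exact ⟨∅, by simpa using hemp, isOpen_empty, fun m => absurd m.2 (notMem_empty _),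
      continuous_of_const fun m => absurd m.2 (notMem_empty _), fun y => isEmptyElim y⟩
  have hYne : (range i).Nonempty := ⟨i ⟨F₀, hF₀⟩, mem_range_self _⟩
  obtain ⟨f, a, hfc, hf0, hf1, hfl, hfa⟩ := exists_dugundji_system hY hYne
  have hpos : ∀ w : ((range i)ᶜ : Set M), 0 < infDist (w : M) (range i) := fun w =>
    (hY.notMem_iff_infDist_pos hYne).1 w.2
  choose b hb using fun l => (a l).2
  choose Γ hΓ using fun l k => exists_nearly_optimal_growth (b l).1.carrier (b k).1.carrier (hpos l)
  -- near a point of `H`, all growths are small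
  have hloc : ∀ F : H, ∀ e > 0, ∃ ρ > 0, ∀ l k m m', f l m ≠ 0 → f k m' ≠ 0 →
      dist (m : M) (i F) < ρ → dist (m' : M) (i F) < ρ → dist (b l) F < e ∧
        IsGrowth (b l).1.carrier (b k).1.carrier e (Γ l k) := by
    intro F e he
    obtain ⟨σ, hσ, hσ'⟩ := exists_growth_near hH h F.2 (half_pos he)
    -- Anchors move by at most a factor 4, and the tolerance `infDist l` is then below `e / 2`, the
    -- other half being the size of the available growth.
    refine ⟨min σ e / 4, by positivity, fun l k m m' hl hk hm hm' => ?_⟩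
    have h1 : min σ e ≤ σ := min_le_left _ _
    have h2 : min σ e ≤ e := min_le_right _ _
    obtain ⟨hl1, hl2⟩ := hfa ⟨i F, mem_range_self F⟩ l m hl
    obtain ⟨hk1, -⟩ := hfa ⟨i F, mem_range_self F⟩ k m' hk
    rw [← hb, hi.dist_eq] at hl1 hk1
    refine ⟨by linarith, (hΓ l k (e / 2) (half_pos he) (hσ' _ _ ?_ ?_)).mono ?_⟩
    · exact lt_of_le_of_lt hl1 (by linarith)
    · exact lt_of_le_of_lt hk1 (by linarith)
    · simp only at hl2
      linarith
  have hne : ∀ F : H, ∀ e > 0, ∃ ρ > 0, ∀ m : ((range i)ᶜ : Set M), dist (m : M) (i F) < ρ →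
      ∃ hne : (growthUnion f Γ m).Nonempty,
        dist (⟨⟨closure (growthUnion f Γ m), isClosed_closure⟩, hne.closure⟩ : Hyperspace X) F
          < e := by
    intro F e he
    have he' : 0 < min e 1 / 3 := by positivity
    have h1 : min e 1 ≤ e := min_le_left _ _
    have h2 : min e 1 ≤ 1 := min_le_right _ _
    obtain ⟨ρ, hρ, hρ'⟩ := hloc F (min e 1 / 3) he'
    refine ⟨ρ, hρ, fun m hm => ?_⟩
    obtain ⟨p, hp⟩ := hf1 m
    have hp0 : f p m ≠ 0 := by rw [hp]; exact one_ne_zero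
    have hbp : (b p).1.carrier ⊆ growthUnion f Γ m := fun z hz =>
      ⟨p, by rw [hp]; norm_num, p, by rw [hp]; norm_num,
        (hρ' p p m m hp0 hp0 hm hm).2.base_subset _ hz⟩
    refine ⟨(b p).1.nonempty'.mono hbp, lt_of_le_of_lt (Hyperspace.dist_le_of_mem
      (r := 2 * (min e 1 / 3) + min e 1 / 6) (by positivity) (fun z hz => ?_) fun z hz => ?_) ?_⟩
    · obtain ⟨w, ⟨l, hl, k, hk, hw⟩, hzw⟩ := Metric.mem_closure_iff.1 hz (min e 1 / 6)
        (by positivity)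
      have hl0 : f l m ≠ 0 := by linarith
      obtain ⟨hlF, hlk⟩ := hρ' l k m m hl0 hk.ne' hm hm
      obtain ⟨v, hv, hwv⟩ := mem_thickening_iff.1 (hlk.subset_thickening _ hw)
      obtain ⟨u, hu, hvu⟩ := Hyperspace.exists_dist_lt (A := (b l).1) (B := F.1) hlF
        (by linarith) hv
      exact ⟨u, hu, by linarith [dist_triangle4 z w v u]⟩
    · obtain ⟨w, hw, hzw⟩ := Hyperspace.exists_dist_lt (A := F.1) (B := (b p).1)
        (by rw [dist_comm]; exact (hρ' p p m m hp0 hp0 hm hm).1) (by linarith) hz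
      exact ⟨w, subset_closure (hbp hw), by linarith⟩
    · linarith
  -- The value `F₀` is a default for an empty union, which does not occur in the neighborhood `V`
  -- chosen below.
  let R : M → Hyperspace X := fun m =>
    if hm : m ∈ range i then (hm.choose : H).1
    else if hm' : (growthUnion f Γ ⟨m, hm⟩).Nonempty then
      ⟨⟨closure (growthUnion f Γ ⟨m, hm⟩), isClosed_closure⟩, hm'.closure⟩ else F₀
  have hRi : ∀ F : H, R (i F) = F := fun F => by
    have hm : i F ∈ range i := mem_range_self F
    simp only [R, dif_pos hm]
    rw [hi.injective hm.choose_spec]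
  have hRnear : ∀ F : H, ∀ e > 0, ∃ ρ > 0, ∀ m, dist m (i F) < ρ → dist (R m) F < e := by
    intro F e he
    obtain ⟨ρ, hρ, hρ'⟩ := hne F e he
    refine ⟨min ρ e, by positivity, fun m hm => ?_⟩
    by_cases hmi : m ∈ range i
    · obtain ⟨F', rfl⟩ := hmi
      rw [hRi]
      rw [hi.dist_eq] at hm
      exact lt_of_lt_of_le hm (min_le_right _ _)
    · obtain ⟨hm', hd⟩ := hρ' ⟨m, hmi⟩ (hm.trans_le (min_le_left _ _))
      simp only [R, dif_neg hmi, dif_pos hm']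
      exact hd
  have hV : ∀ F : H, ∃ ρ > 0, (∀ m, dist m (i F) < ρ → R m ∈ H) ∧
      (∀ m : ((range i)ᶜ : Set M), dist (m : M) (i F) < ρ → (growthUnion f Γ m).Nonempty) ∧
      ∀ l k m m', f l m ≠ 0 → f k m' ≠ 0 →
        dist (m : M) (i F) < ρ → dist (m' : M) (i F) < ρ →
        IsGrowth (b l).1.carrier (b k).1.carrier 1 (Γ l k) := by
    intro F
    obtain ⟨e, he, heH⟩ := Metric.isOpen_iff.1 hH F.1 F.2
    obtain ⟨ρ₁, hρ₁, h₁⟩ := hRnear F e he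
    obtain ⟨ρ₂, hρ₂, h₂⟩ := hne F 1 one_pos
    obtain ⟨ρ₃, hρ₃, h₃⟩ := hloc F 1 one_pos
    have k1 : min ρ₁ (min ρ₂ ρ₃) ≤ ρ₁ := min_le_left _ _
    have k2 : min ρ₁ (min ρ₂ ρ₃) ≤ ρ₂ := (min_le_right _ _).trans (min_le_left _ _)
    have k3 : min ρ₁ (min ρ₂ ρ₃) ≤ ρ₃ := (min_le_right _ _).trans (min_le_right _ _)
    exact ⟨min ρ₁ (min ρ₂ ρ₃), by positivity, fun m hm => heH (h₁ m (hm.trans_le k1)),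
      fun m hm => (h₂ m (hm.trans_le k2)).1, fun l k m m' hl hk hm hm' =>
      (h₃ l k m m' hl hk (hm.trans_le k3) (hm'.trans_le k3)).2⟩
  choose ρ hρ hρH hρne hρΓ using hV
  let V : Set M := ⋃ F : H, ball (i F) (ρ F)
  have hVH : ∀ v ∈ V, R v ∈ H := fun v hv => by
    obtain ⟨F, hF⟩ := mem_iUnion.1 hv
    exact hρH F v hF
  have hiV : range i ⊆ V := by
    rintro _ ⟨F, rfl⟩
    exact mem_iUnion.2 ⟨F, mem_ball_self (hρ F)⟩
  have hRc : ∀ v ∈ V, ContinuousAt R v := by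
    intro v hv
    by_cases hvi : v ∈ range i
    · obtain ⟨F, rfl⟩ := hvi
      rw [Metric.continuousAt_iff]
      intro e he
      obtain ⟨τ, hτ, hτ'⟩ := hRnear F e he
      exact ⟨τ, hτ, fun {m} hm => by rw [hRi]; exact hτ' m hm⟩
    · obtain ⟨F, hF⟩ := mem_iUnion.1 hv
      have hemb : IsOpenEmbedding ((↑) : ((range i)ᶜ : Set M) → M) :=
        hY.isOpen_compl.isOpenEmbedding_subtypeVal
      rw [show v = ((⟨v, hvi⟩ : ((range i)ᶜ : Set M)) : M) from rfl, ← hemb.continuousAt_iff]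
      set m₀ : ((range i)ᶜ : Set M) := ⟨v, hvi⟩ with hm₀
      have hB : ∀ᶠ m : ((range i)ᶜ : Set M) in 𝓝 m₀, dist (m : M) (i F) < ρ F :=
        (continuous_subtype_val.dist continuous_const).continuousAt.eventually_lt_const hF
      obtain ⟨t, ht, htfin⟩ := hfl m₀
      have hJfin : {l | (Function.support (f l) ∩
          (t ∩ {m | dist (m : M) (i F) < ρ F})).Nonempty}.Finite :=
        htfin.subset fun l hl => hl.mono (inter_subset_inter_right _ inter_subset_left)
      obtain ⟨p, hp⟩ := hf1 m₀
      have hev : ∀ ε > 0, ∀ᶠ m in 𝓝 m₀,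
          growthUnion f Γ m ⊆ thickening ε (growthUnion f Γ m₀) ∧
          growthUnion f Γ m₀ ⊆ thickening ε (growthUnion f Γ m) := fun ε hε =>
        -- Continuity off the image needs only that the growths exist, so the crude size 1 suffices.
        eventually_growthUnion_subset (A := fun l => (b l).1.carrier) hfc hf0
        (Γ := Γ) (I := hJfin.toFinset) (m₀ := m₀) (e := 1) (by
          filter_upwards [ht, hB] with m hm1 hm2 l hl
          rw [Set.Finite.mem_toFinset]
          exact ⟨m, hl, hm1, hm2⟩) (by
          intro l hl k hk
          rw [Set.Finite.mem_toFinset] at hl hk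
          obtain ⟨m, hm1, -, hm2⟩ := hl
          obtain ⟨m', hm1', -, hm2'⟩ := hk
          exact hρΓ F l k m m' hm1 hm1' hm2 hm2') hp hε
      rw [Metric.continuousAt_iff']
      intro ε hε
      filter_upwards [hB, hev (ε / 4) (by positivity)] with m hm hsub
      have hclose : ∀ m' m'' : ((range i)ᶜ : Set M),
          growthUnion f Γ m' ⊆ thickening (ε / 4) (growthUnion f Γ m'') →
          ∀ z ∈ closure (growthUnion f Γ m'), ∃ w ∈ closure (growthUnion f Γ m''),
            dist z w ≤ ε / 2 := by
        intro m' m'' hs z hz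
        obtain ⟨w, hw, hzw⟩ := Metric.mem_closure_iff.1 hz (ε / 4) (by positivity)
        obtain ⟨u, hu, hwu⟩ := mem_thickening_iff.1 (hs hw)
        exact ⟨u, subset_closure hu, by linarith [dist_triangle z w u]⟩
      have hRm : ∀ m : ((range i)ᶜ : Set M), dist (m : M) (i F) < ρ F →
          (R m).carrier = closure (growthUnion f Γ m) := fun m hm => by
        have h1 : (m : M) ∉ range i := m.2
        have h2 := hρne F m hm
        simp only [R, dif_neg h1, Subtype.coe_eta, dif_pos h2]
      refine lt_of_le_of_lt (Hyperspace.dist_le_of_mem (half_pos hε).le ?_ ?_)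
        (half_lt_self hε)
      · simp only [Function.comp_apply]
        rw [hRm m hm, hRm m₀ hF]
        exact hclose _ _ hsub.1
      · simp only [Function.comp_apply]
        rw [hRm m hm, hRm m₀ hF]
        exact hclose _ _ hsub.2
  refine ⟨V, hiV, isOpen_iUnion fun F => isOpen_ball, fun v => ⟨R v, hVH v v.2⟩, ?_, fun F =>
    Subtype.ext (hRi F)⟩
  refine Continuous.subtype_mk (continuous_iff_continuousAt.2 fun v => ?_) _
  exact (hRc v v.2).comp continuous_subtype_val.continuousAt

theorem theorem3 {X : Type u} [MetricSpace X] (H : Set (Hyperspace X)) (hopen : IsOpen H)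
    (hD : ∀ F ∈ H, discreteHyperspace F.carrier ⊆ H) :
    List.TFAE [
      IsANR H,
      LocallyPathConnectedSpace H,
      IsLocallyChainConnected H,
      ∀ F ∈ H, IsLocallyChainConnectedAt (discreteHyperspace F.carrier),
      ∀ F ∈ H, IsUniformlyLocallyChainEquiConnectedAt F.carrier,
      ∀ F ∈ H, IsUniformlyLocallyTraceEquiConnectedAt F.carrier] := by
  tfae_have 1 → 2 := fun h => h.locallyPathConnectedSpace
  tfae_have 2 → 3 := fun _ => isLocallyChainConnected_of_locallyPathConnectedSpace
  tfae_have 3 → 4 := fun h F hF => h.discreteHyperspace (hD F hF)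
  tfae_have 4 → 5 := fun h F hF => (h F hF).isUniformlyLocallyChainEquiConnectedAt F.isClosed'
  tfae_have 5 → 6 := fun h F hF => by
    obtain ⟨r, hr, -, -, hG⟩ := Hyperspace.exists_cthicken_mem hopen hF
    exact IsUniformlyLocallyTraceEquiConnectedAt.of_chain hr (h _ hG)
  tfae_have 6 → 1 := isANR_of_trace hopen
  tfae_finish
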